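/- Let $(X,\mathcal B,m)$ be a probability space and let $\tau:X\to X$ be an invertible, bimeasurable, measure preserving transformation. Let $(\nu_n)_{n\ge 1}$ be a sequence of probability measures on $\mathbb Z$, each strictly aperiodic (its support is not contained in a coset of a proper subgroup of $\mathbb Z$). Write $\hat\nu(t)=\sum_{k\in\mathbb Z}\nu(k)e^{2\pi i k t}$, $E(\nu)=\sum_{k}k\,\nu(k)$ and $m_2(\nu)=\sum_{k}|k|^2\nu(k)$. Assume that 1. $E(\nu_n)=0$ for all $n\ge1$; 2. $\sum_{i=1}^{n}m_2(\nu_i)=O(n)$ as $n\to\infty$ (in particular every $m_2(\nu_i)$ is finite); 3. there are a constant $C>0$ and an integer $N_0>0$ such that $|\hat\nu_n(t)|\le e^{-Ct^2}$ for all $n>N_0$ and all $t\in[-1/2,1/2)$. Let $\mu_n=\nu_1*\cdots*\nu_n$ for $n\ge1$. Then each $\hat\mu_n$ is twice continuously differentiable on $\mathbb R$ and $$\sup_{n\ge1}\int_{-1/2}^{1/2}|\hat\mu_n''(t)|\,|t|\,dt<\infty .$$ Moreover, with $\mu_nf(x)=\sum_{k\in\mathbb Z}\mu_n(k)f(\tau^kx)$,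 the maximal operator $Mf(x)=\sup_{n\ge1}|\mu_nf(x)|$ is of weak type $(1,1)$: there is a constant $C'>0$ such that for every real-valued $f\in L^1(X,m)$ and every $\lambda>0$, $$m\{x\in X: Mf(x)>\lambda\}\le \frac{C'}{\lambda}\,\|f\|_{L^1(m)} .$$ -/

import Mathlib

open MeasureTheory Filter

open scoped ENNReal NNReal

noncomputable section

namespace ConvolutionAverages

/-- A probability measure on `ℤ` is strictly aperiodic if its support is not contained in a coset of
a proper subgroup of `ℤ`. -/
def StrictlyAperiodic (ν : Measure ℤ) : Prop :=
  ¬ ∃ (H : AddSubgroup ℤ) (a : ℤ), H ≠ ⊤ ∧ ∀ k : ℤ, ν {k} ≠ 0 → ∃ h ∈ H, k = a + h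

/-- The expectation `∑ k, k ν(k)`; the series converges absolutely whenever the second moment of
the probability measure `ν` is finite. -/
def expectation (ν : Measure ℤ) : ℝ :=
  ∑' k : ℤ, (k : ℝ) * ν.real {k}

/-- The second moment `∑ k, |k|² ν(k)`, with values in `[0, ∞]`. -/
def secondMoment (ν : Measure ℤ) : ℝ≥0∞ :=
  ∑' k : ℤ, ENNReal.ofReal (|(k : ℝ)| ^ 2) * ν {k}

/-- The Fourier transform `t ↦ ∑ k, ν(k) e^{2πikt}` of a measure on `ℤ`. -/
def fourier (ν : Measure ℤ) (t : ℝ) : ℂ :=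
  ∑' k : ℤ, (ν.real {k} : ℂ) * Complex.exp (2 * Real.pi * Complex.I * k * t)

/-- The convolution `ν 1 ∗ ⋯ ∗ ν n`; the empty convolution (`n = 0`) is the unit mass at `0`. -/
def convProd (ν : ℕ → Measure ℤ) : ℕ → Measure ℤ
  | 0 => Measure.dirac 0
  | n + 1 => (convProd ν n).conv (ν (n + 1))

variable {X : Type*} [MeasurableSpace X]

/-- The iterate `τ ^ k`, `k ∈ ℤ`, of an invertible measurable transformation, as a function. -/
def iter (τ : X ≃ᵐ X) (k : ℤ) : X → X :=
  ⇑((τ.toEquiv : Equiv.Perm X) ^ k)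

/-- The weighted average `∑ k, μ(k) f(τ^k x)`. For integrable `f` and measure preserving `τ` the
series converges absolutely for almost every `x`. -/
def average (τ : X ≃ᵐ X) (μ : Measure ℤ) (f : X → ℝ) (x : X) : ℝ :=
  ∑' k : ℤ, μ.real {k} * f (iter τ k x)

/-- The maximal function `sup_{n ≥ 1} |μ_n f(x)|`, with values in `[0, ∞]`. -/
def maximal (τ : X ≃ᵐ X) (μ : ℕ → Measure ℤ) (f : X → ℝ) (x : X) : ℝ≥0∞ :=
  ⨆ (n : ℕ) (_ : 1 ≤ n), ENNReal.ofReal |average τ (μ n) f x|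

/-- An operator `T` on `L¹(m)` with values in the `[0, ∞]`-valued functions is of weak type
`(1, 1)`: there is a constant `C`, independent of `f` and `lam`, such that
`m {x | T f x > lam} ≤ (C / lam) ‖f‖₁`. -/
def WeakType11 (m : Measure X) (T : (X → ℝ) → X → ℝ≥0∞) : Prop :=
  ∃ C : ℝ, 0 < C ∧ ∀ f : X → ℝ, Integrable f m → ∀ lam : ℝ, 0 < lam →
    m {x | ENNReal.ofReal lam < T f x} ≤ ENNReal.ofReal (C / lam * ∫ x, |f x| ∂m)

end ConvolutionAverages

end

/-!
For `|t| ≤ 1 / 2` and all but finitely many `i`, the Fourier transform of `νᵢ` is at most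
`exp (-C t²)`, a quantity bounded below there. Its second derivative is `O(m₂(νᵢ))` and, because the
mean vanishes, its first derivative is `O(m₂(νᵢ) |t|)`. The product rule therefore bounds the second
derivative of the transform of `μₙ` by a multiple of `(n + n² t²) exp (-C n t²)`, whose integral
against `|t|` is bounded in `n`. By Fourier inversion, `k ↦ k² μₙ(k)` is then Lipschitz uniformly in
`n`, which gives the regularity `μₙ(x) ≤ μₙ(y) + D |x - y| / |x|²` for `2 |x - y| ≤ |x|`. This is
all that the Calderón–Zygmund decomposition needs in order to bound the maximal convolution operator
on `ℤ`, and Calderón's transference principle carries that bound over to `τ`.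
-/

noncomputable section

namespace ConvolutionAverages

open Finset

lemma count_eq_tsum_indicator {α : Type*} [MeasurableSpace α] [DiscreteMeasurableSpace α]
    (S : Set α) : Measure.count S = ∑' i, S.indicator (1 : α → ℝ≥0∞) i := by
  rw [← lintegral_count, lintegral_indicator_one .of_discrete]

section CellPartition

/-- A partition of `α` into finite cells, encoded by the map sending each point to its cell. -/
structure CellPartition (α : Type*) where
  cell : α → Finset α
  mem_cell_iff : ∀ {i j}, j ∈ cell i ↔ cell j = cell i

namespace CellPartition

variable {α : Type*} (P : CellPartition α)

lemma self_mem_cell (i : α) : i ∈ P.cell i := P.mem_cell_iff.2 rfl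

lemma mem_cell_comm {i j : α} : i ∈ P.cell j ↔ j ∈ P.cell i := by
  rw [P.mem_cell_iff, P.mem_cell_iff, eq_comm]

lemma card_cell_ne_zero (i : α) : (#(P.cell i) : ℝ≥0∞) ≠ 0 :=
  Nat.cast_ne_zero.2 (card_ne_zero_of_mem (P.self_mem_cell i))

/-- The function replacing `f` on each cell by its mean over that cell, that is, the conditional
expectation of `f` given the partition. -/
def mean (f : α → ℝ≥0∞) (i : α) : ℝ≥0∞ :=
  (∑ j ∈ P.cell i, f j) / #(P.cell i)

lemma mean_eq_of_mem_cell (f : α → ℝ≥0∞) {i j : α} (h : j ∈ P.cell i) :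
    P.mean f j = P.mean f i := by
  rw [mean, mean, P.mem_cell_iff.1 h]

lemma mean_const (c : ℝ≥0∞) (i : α) : P.mean (fun _ => c) i = c := by
  rw [mean, sum_const, nsmul_eq_mul, mul_comm,
    ENNReal.mul_div_cancel_right (P.card_cell_ne_zero i) (ENNReal.natCast_ne_top _)]

lemma mean_eq_self_of_card_eq_one (f : α → ℝ≥0∞) {i : α} (h : #(P.cell i) = 1) :
    P.mean f i = f i := by
  obtain ⟨j, hj⟩ := card_eq_one.1 h
  obtain rfl : i = j := by simpa [hj] using P.self_mem_cell i
  simp [mean, hj]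

lemma le_mean_add {f : α → ℝ≥0∞} {i : α} {a b : ℝ≥0∞} (h : ∀ j ∈ P.cell i, a ≤ f j + b) :
    a ≤ P.mean f i + b := by
  calc a = P.mean (fun _ => a) i := (P.mean_const a i).symm
    _ ≤ P.mean (fun j => f j + b) i := ENNReal.div_le_div_right (sum_le_sum h) _
    _ = P.mean f i + P.mean (fun _ => b) i := by
        rw [mean, mean, mean, sum_add_distrib, ENNReal.add_div]
    _ = P.mean f i + b := by rw [mean_const]

lemma tsum_mean_mul (f g : α → ℝ≥0∞) : ∑' i, P.mean f i * g i = ∑' i, f i * P.mean g i := by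
  classical
  have expand (u v : α → ℝ≥0∞) (i : α) :
      P.mean u i * v i = ∑' j, if j ∈ P.cell i then u j * v i / #(P.cell i) else 0 := by
    rw [tsum_eq_sum (s := P.cell i) fun j hj => if_neg hj, sum_congr rfl fun j hj => if_pos hj]
    simp only [mean, div_eq_mul_inv, sum_mul]
    exact sum_congr rfl fun j _ => mul_right_comm _ _ _
  simp only [mul_comm (f _) (P.mean g _), expand]
  rw [ENNReal.tsum_comm]
  refine tsum_congr fun j => tsum_congr fun i => ?_
  by_cases h : i ∈ P.cell j
  · rw [if_pos h, if_pos (P.mem_cell_comm.1 h), P.mem_cell_iff.1 h, mul_comm]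
  · rw [if_neg h, if_neg (mt P.mem_cell_comm.2 h)]

lemma tsum_mean (f : α → ℝ≥0∞) : ∑' i, P.mean f i = ∑' i, f i := by
  simpa [P.mean_const] using P.tsum_mean_mul f fun _ => 1

lemma count_lt_mean_le [MeasurableSpace α] [DiscreteMeasurableSpace α] (f : α → ℝ≥0∞)
    {lam : ℝ≥0∞} (h0 : lam ≠ 0) (htop : lam ≠ ∞) :
    Measure.count {i | lam < P.mean f i} ≤ (∑' i, f i) / lam := by
  have markov := meas_ge_le_lintegral_div (μ := Measure.count)
    (Measurable.of_discrete (f := P.mean f)).aemeasurable h0 htop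
  rw [lintegral_count, P.tsum_mean] at markov
  exact (measure_mono (Set.ofPred_subset_ofPred.2 fun _ => le_of_lt)).trans markov

end CellPartition

end CellPartition

section IntervalPartition

/-- The cells of a partition of `ℤ` are intervals: a finite set of integers is an interval exactly
when its diameter is smaller than its cardinality. -/
def CellPartition.IsInterval (P : CellPartition ℤ) : Prop :=
  ∀ ⦃i j⦄, j ∈ P.cell i → (i - j).natAbs < #(P.cell i)

lemma tsum_ite_natAbs_sub_lt_le (i : ℤ) (l : ℕ) (c : ℝ≥0∞) :
    ∑' j : ℤ, (if (i - j).natAbs < l then c else 0) ≤ 2 * l * c := by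
  have hball : ∀ j ∉ Ioo (i - l) (i + l), (if (i - j).natAbs < l then c else 0) = 0 := by
    intro j hj
    rw [Finset.mem_Ioo] at hj
    exact if_neg (by omega)
  calc ∑' j : ℤ, (if (i - j).natAbs < l then c else 0)
      = ∑ j ∈ Ioo (i - l) (i + l), (if (i - j).natAbs < l then c else 0) := tsum_eq_sum hball
    _ ≤ #(Ioo (i - l) (i + l)) • c := sum_le_card_nsmul _ _ _ fun j _ => by split_ifs <;> simp
    _ ≤ (2 * l : ℕ) • c := by
        gcongr
        rw [Int.card_Ioo]
        omega
    _ = 2 * l * c := by simp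

lemma one_le_tsum_of_mem_dilate {P : CellPartition ℤ} (hP : P.IsInterval) {B : Set ℤ}
    (hB : ∀ i ∈ B, ∀ j ∈ P.cell i, j ∈ B) {i j : ℤ} (hi : i ∈ B)
    (hij : (i - j).natAbs < 2 * #(P.cell i)) :
    1 ≤ ∑' i, B.indicator 1 i *
      if (i - j).natAbs < 3 * #(P.cell i) then (#(P.cell i) : ℝ≥0∞)⁻¹ else 0 := by
  calc (1 : ℝ≥0∞) = ∑ _ ∈ P.cell i, (#(P.cell i) : ℝ≥0∞)⁻¹ := by
        rw [sum_const, nsmul_eq_mul,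
          ENNReal.mul_inv_cancel (P.card_cell_ne_zero i) (ENNReal.natCast_ne_top _)]
    _ = ∑ i' ∈ P.cell i, B.indicator 1 i' *
          if (i' - j).natAbs < 3 * #(P.cell i') then (#(P.cell i') : ℝ≥0∞)⁻¹ else 0 := by
        refine sum_congr rfl fun i' hi' => ?_
        have hnear := hP hi'
        rw [Set.indicator_of_mem (hB i hi i' hi'), Pi.one_apply, one_mul, P.mem_cell_iff.1 hi']
        exact (if_pos (by omega)).symm
    _ ≤ _ := ENNReal.sum_le_tsum _

lemma count_dilate_le {P : CellPartition ℤ} (hP : P.IsInterval) {B : Set ℤ}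
    (hB : ∀ i ∈ B, ∀ j ∈ P.cell i, j ∈ B) :
    Measure.count {j | ∃ i ∈ B, (i - j).natAbs < 2 * #(P.cell i)} ≤ 6 * Measure.count B := by
  set w : ℤ → ℤ → ℝ≥0∞ := fun i j =>
    if (i - j).natAbs < 3 * #(P.cell i) then (#(P.cell i) : ℝ≥0∞)⁻¹ else 0
  have hcover : {j | ∃ i ∈ B, (i - j).natAbs < 2 * #(P.cell i)}.indicator 1 ≤
      fun j => ∑' i, B.indicator 1 i * w i j := by
    refine Set.indicator_le fun j hj => ?_
    obtain ⟨i, hi, hij⟩ := hj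
    exact one_le_tsum_of_mem_dilate hP hB hi hij
  have hmass (i : ℤ) : ∑' j, w i j ≤ 6 := by
    refine (tsum_ite_natAbs_sub_lt_le i _ _).trans ?_
    calc 2 * ((3 * #(P.cell i) : ℕ) : ℝ≥0∞) * (#(P.cell i) : ℝ≥0∞)⁻¹
        = 6 * (#(P.cell i) * (#(P.cell i) : ℝ≥0∞)⁻¹) := by
          push_cast
          ring
      _ ≤ 6 := mul_le_of_le_one_right' (ENNReal.mul_inv_le_one _)
  calc Measure.count {j | ∃ i ∈ B, (i - j).natAbs < 2 * #(P.cell i)}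
      ≤ ∑' j, ∑' i, B.indicator 1 i * w i j := by
        rw [count_eq_tsum_indicator]
        exact ENNReal.tsum_le_tsum hcover
    _ = ∑' i, B.indicator 1 i * ∑' j, w i j := by
        rw [ENNReal.tsum_comm]
        simp only [ENNReal.tsum_mul_left]
    _ ≤ ∑' i, B.indicator 1 i * 6 := by
        gcongr
        exact hmass _
    _ = 6 * Measure.count B := by rw [ENNReal.tsum_mul_right, ← count_eq_tsum_indicator, mul_comm]

/-- The Bellow–Calderón regularity condition on a kernel: moving from `x` to a point `y` within
`|x| / 2` loses at most `D |x - y| / |x|²`. At `x = 0` it forces `y = 0`, and the quotient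
`0 / 0` is `0`. -/
def HasDecayingDifferences (D : ℝ≥0∞) (κ : ℤ → ℝ≥0∞) : Prop :=
  ∀ x y : ℤ, 2 * (x - y).natAbs ≤ x.natAbs →
    κ x ≤ κ y + D * ((x - y).natAbs / (x.natAbs : ℝ≥0∞) ^ 2)

/-- The loss `l / |d|²` incurred when a kernel with decaying differences is moved by at most `l`
from a point `d` with `|d| ≥ 2 l`. -/
def regularityTail (l : ℕ) (d : ℤ) : ℝ≥0∞ :=
  if 2 * l ≤ d.natAbs then l / (d.natAbs : ℝ≥0∞) ^ 2 else 0

lemma tsum_inv_sq_ge_two_mul_le {l : ℕ} (hl : l ≠ 0) :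
    ∑' d : ℕ, (if 2 * l ≤ d then ((d : ℝ≥0∞) ^ 2)⁻¹ else 0) ≤ (l : ℝ≥0∞)⁻¹ := by
  refine ENNReal.tsum_le_of_sum_range_le fun N => ?_
  have hrange : {d ∈ range N | 2 * l ≤ d} = Ioo (2 * l - 1) N := by
    ext d
    simp only [mem_filter, mem_range, Finset.mem_Ioo]
    omega
  have hcast : ∀ d ∈ Ioo (2 * l - 1) N, ((d : ℝ≥0∞) ^ 2)⁻¹ = ENNReal.ofReal ((d : ℝ) ^ 2)⁻¹ := by
    intro d hd
    have : 0 < d := (Nat.zero_le _).trans_lt (Finset.mem_Ioo.1 hd).1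
    rw [ENNReal.ofReal_inv_of_pos (by positivity), ENNReal.ofReal_pow (by positivity),
      ENNReal.ofReal_natCast]
  have hreal : ∑ d ∈ Ioo (2 * l - 1) N, ((d : ℝ) ^ 2)⁻¹ ≤ (l : ℝ)⁻¹ := by
    refine (sum_Ioo_inv_sq_le (α := ℝ) (2 * l - 1) N).trans_eq ?_
    rw [Nat.cast_sub (by omega)]
    push_cast
    field_simp
    ring
  rw [← sum_filter, hrange, sum_congr rfl hcast,
    ← ENNReal.ofReal_sum_of_nonneg fun d _ => by positivity, ← ENNReal.ofReal_natCast,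
    ← ENNReal.ofReal_inv_of_pos (by positivity)]
  exact ENNReal.ofReal_le_ofReal hreal

lemma tsum_regularityTail_le {l : ℕ} (hl : l ≠ 0) : ∑' d, regularityTail l d ≤ 2 := by
  set u : ℕ → ℝ≥0∞ := fun d => if 2 * l ≤ d then ((d : ℝ≥0∞) ^ 2)⁻¹ else 0
  have htail (d : ℤ) : regularityTail l d = l * u d.natAbs := by
    simp only [regularityTail, u, div_eq_mul_inv, mul_ite, mul_zero]
  have hneg (n : ℕ) : (-((n : ℤ) + 1)).natAbs = n + 1 := by omega
  calc ∑' d, regularityTail l d = l * (∑' n, u n + ∑' n, u (n + 1)) := by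
        simp only [htail, ENNReal.tsum_mul_left,
          tsum_of_nat_of_neg_add_one (f := fun d : ℤ => u d.natAbs) ENNReal.summable
            ENNReal.summable, Int.natAbs_natCast, hneg]
    _ ≤ l * ((l : ℝ≥0∞)⁻¹ + (l : ℝ≥0∞)⁻¹) := by
        gcongr
        · exact tsum_inv_sq_ge_two_mul_le hl
        · exact (ENNReal.tsum_comp_le_tsum_of_injective (add_left_injective 1) u).trans
            (tsum_inv_sq_ge_two_mul_le hl)
    _ = 2 * (l * (l : ℝ≥0∞)⁻¹) := by ring
    _ ≤ 2 * 1 := by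
        gcongr
        exact ENNReal.mul_inv_le_one _
    _ = 2 := mul_one 2

lemma tsum_tsum_mul_regularityTail_le (P : CellPartition ℤ) (φ : ℤ → ℝ≥0∞) :
    ∑' j, ∑' i, φ i * regularityTail #(P.cell i) (i - j) ≤ 2 * ∑' i, φ i := by
  have hshift (i : ℤ) : ∑' j, regularityTail #(P.cell i) (i - j) =
      ∑' d, regularityTail #(P.cell i) d := (Equiv.subLeft i).tsum_eq _
  rw [ENNReal.tsum_comm, ← ENNReal.tsum_mul_left]
  refine ENNReal.tsum_le_tsum fun i => ?_
  rw [ENNReal.tsum_mul_left, hshift, mul_comm 2]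
  gcongr
  exact tsum_regularityTail_le (by exact_mod_cast P.card_cell_ne_zero i)

lemma HasDecayingDifferences.le_mean_add {D : ℝ≥0∞} {κ : ℤ → ℝ≥0∞}
    (hκ : HasDecayingDifferences D κ) {P : CellPartition ℤ} (hP : P.IsInterval) {i j : ℤ}
    (hfar : 1 < #(P.cell i) → 2 * #(P.cell i) ≤ (i - j).natAbs) :
    κ (i - j) ≤ P.mean (fun i' => κ (i' - j)) i + D * regularityTail #(P.cell i) (i - j) := by
  rcases le_or_gt #(P.cell i) 1 with h | h
  · have hone : #(P.cell i) = 1 := le_antisymm h (card_pos.2 ⟨i, P.self_mem_cell i⟩)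
    rw [P.mean_eq_self_of_card_eq_one _ hone]
    exact le_self_add
  · refine P.le_mean_add fun i' hi' => ?_
    have hnear := hP hi'
    refine (hκ (i - j) (i' - j) (by have := hfar h; omega)).trans ?_
    rw [regularityTail, if_pos (hfar h)]
    gcongr
    omega

/-- The second sum on the right replaces the cancellation of the bad part `φ - P.mean φ` in the
usual signed form of the Calderón–Zygmund argument. -/
lemma HasDecayingDifferences.tsum_mul_le {D : ℝ≥0∞} {κ : ℤ → ℝ≥0∞}
    (hκ : HasDecayingDifferences D κ) {P : CellPartition ℤ} (hP : P.IsInterval) (φ : ℤ → ℝ≥0∞)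
    {j : ℤ} (hfar : ∀ i, 1 < #(P.cell i) → 2 * #(P.cell i) ≤ (i - j).natAbs) :
    ∑' i, κ (i - j) * φ i ≤ ∑' i, κ (i - j) * P.mean φ i +
      D * ∑' i, φ i * regularityTail #(P.cell i) (i - j) := by
  rw [← P.tsum_mean_mul, ← ENNReal.tsum_mul_left, ← ENNReal.tsum_add]
  refine ENNReal.tsum_le_tsum fun i => ?_
  calc κ (i - j) * φ i
      ≤ (P.mean (fun i' => κ (i' - j)) i + D * regularityTail #(P.cell i) (i - j)) * φ i := by
        gcongr
        exact hκ.le_mean_add hP (hfar i)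
    _ = _ := by ring

end IntervalPartition

section DyadicStopping

/-- The dyadic interval of length `2 ^ s` in `ℤ` that contains `i`. -/
def dyadicBlock (s : ℕ) (i : ℤ) : Finset ℤ :=
  Ico (i / 2 ^ s * 2 ^ s) (i / 2 ^ s * 2 ^ s + 2 ^ s)

lemma mem_dyadicBlock {s : ℕ} {i j : ℤ} : j ∈ dyadicBlock s i ↔ j / 2 ^ s = i / 2 ^ s := by
  rw [dyadicBlock, Finset.mem_Ico, Int.ediv_eq_iff_of_pos (by positivity)]

lemma self_mem_dyadicBlock (s : ℕ) (i : ℤ) : i ∈ dyadicBlock s i := mem_dyadicBlock.2 rfl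

lemma card_dyadicBlock (s : ℕ) (i : ℤ) : #(dyadicBlock s i) = 2 ^ s := by
  rw [dyadicBlock, Int.card_Ico, add_sub_cancel_left]
  exact_mod_cast Int.toNat_natCast (2 ^ s)

lemma natAbs_sub_lt_of_mem_dyadicBlock {s : ℕ} {i j : ℤ} (h : j ∈ dyadicBlock s i) :
    (i - j).natAbs < 2 ^ s := by
  have hi := self_mem_dyadicBlock s i
  rw [dyadicBlock, Finset.mem_Ico] at h hi
  zify
  rw [abs_lt]
  constructor <;> linarith [h.1, h.2, hi.1, hi.2]

lemma dyadicBlock_eq_of_mem {s t : ℕ} (hst : s ≤ t) {i j : ℤ} (h : j ∈ dyadicBlock s i) :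
    dyadicBlock t j = dyadicBlock t i := by
  obtain ⟨r, rfl⟩ := Nat.exists_eq_add_of_le hst
  have hdiv : j / 2 ^ (s + r) = i / 2 ^ (s + r) := by
    rw [pow_add, ← Int.ediv_ediv_of_nonneg (by positivity), mem_dyadicBlock.1 h,
      Int.ediv_ediv_of_nonneg (by positivity)]
  rw [dyadicBlock, dyadicBlock, hdiv]

lemma dyadicBlock_subset {s t : ℕ} (hst : s ≤ t) (i : ℤ) :
    dyadicBlock s i ⊆ dyadicBlock t i := fun j hj =>
  dyadicBlock_eq_of_mem hst hj ▸ self_mem_dyadicBlock t j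

/-- The mean of `φ` over the dyadic interval of length `2 ^ s` that contains `i`. -/
def dyadicMean (φ : ℤ → ℝ≥0∞) (s : ℕ) (i : ℤ) : ℝ≥0∞ :=
  (∑ j ∈ dyadicBlock s i, φ j) / 2 ^ s

lemma dyadicMean_eq_of_mem (φ : ℤ → ℝ≥0∞) {s t : ℕ} (hst : s ≤ t) {i j : ℤ}
    (h : j ∈ dyadicBlock s i) : dyadicMean φ t j = dyadicMean φ t i := by
  rw [dyadicMean, dyadicMean, dyadicBlock_eq_of_mem hst h]

lemma dyadicMean_le_two_mul_succ (φ : ℤ → ℝ≥0∞) (s : ℕ) (i : ℤ) :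
    dyadicMean φ s i ≤ 2 * dyadicMean φ (s + 1) i := by
  calc (∑ j ∈ dyadicBlock s i, φ j) / 2 ^ s
      ≤ (∑ j ∈ dyadicBlock (s + 1) i, φ j) / 2 ^ s := by
        gcongr
        exact dyadicBlock_subset s.le_succ i
    _ = 2 * ((∑ j ∈ dyadicBlock (s + 1) i, φ j) / 2 ^ (s + 1)) := by
        rw [pow_succ', ← mul_div_assoc,
          ENNReal.mul_div_mul_left _ _ two_ne_zero ENNReal.ofNat_ne_top]

lemma bddAbove_lt_dyadicMean {φ : ℤ → ℝ≥0∞} (hφ : ∑' i, φ i ≠ ∞) {lam : ℝ≥0∞} (h0 : lam ≠ 0)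
    (i : ℤ) : BddAbove {s | lam < dyadicMean φ s i} := by
  obtain ⟨N, hN⟩ := ENNReal.exists_nat_mul_gt h0 hφ
  refine ⟨N, fun s (hs : lam < dyadicMean φ s i) => ?_⟩
  have hlt : (2 ^ s : ℝ≥0∞) * lam < N * lam :=
    calc 2 ^ s * lam = lam * 2 ^ s := mul_comm _ _
      _ ≤ ∑ j ∈ dyadicBlock s i, φ j := ENNReal.mul_le_of_le_div hs.le
      _ ≤ ∑' j, φ j := ENNReal.sum_le_tsum _
      _ < N * lam := hN
  have hpow : 2 ^ s < N := by exact_mod_cast lt_of_mul_lt_mul_right' hlt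
  exact (Nat.lt_two_pow_self.trans hpow).le

/-- The largest scale `s` at which the dyadic mean of `φ` around `i` exceeds `lam`. The value is
`0` when there is no such `s` or no largest one, so that the block of this scale is then `{i}`. -/
def stoppingScale (φ : ℤ → ℝ≥0∞) (lam : ℝ≥0∞) (i : ℤ) : ℕ :=
  sSup {s | lam < dyadicMean φ s i}

lemma isGreatest_stoppingScale {φ : ℤ → ℝ≥0∞} {lam : ℝ≥0∞} {i : ℤ}
    (h : stoppingScale φ lam i ≠ 0) :
    IsGreatest {s | lam < dyadicMean φ s i} (stoppingScale φ lam i) := by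
  by_cases hb : BddAbove {s | lam < dyadicMean φ s i}
  · refine ⟨Nat.sSup_mem (Set.nonempty_iff_ne_empty.2 fun hempty => h ?_) hb,
      fun s hs => le_csSup hb hs⟩
    rw [stoppingScale, hempty, csSup_empty, bot_eq_zero]
  · exact absurd (Nat.sSup_of_not_bddAbove hb) h

lemma dyadicMean_succ_stoppingScale_le {φ : ℤ → ℝ≥0∞} (hφ : ∑' i, φ i ≠ ∞) {lam : ℝ≥0∞}
    (h0 : lam ≠ 0) (i : ℤ) : dyadicMean φ (stoppingScale φ lam i + 1) i ≤ lam :=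
  not_lt.1 fun h => (Nat.lt_succ_self _).not_ge (le_csSup (bddAbove_lt_dyadicMean hφ h0 i) h)

lemma stoppingScale_eq_of_mem (φ : ℤ → ℝ≥0∞) (lam : ℝ≥0∞) {i j : ℤ}
    (h : j ∈ dyadicBlock (stoppingScale φ lam i) i) :
    stoppingScale φ lam j = stoppingScale φ lam i := by
  by_cases hzero : stoppingScale φ lam i = 0
  · have hij := natAbs_sub_lt_of_mem_dyadicBlock h
    rw [hzero, pow_zero] at hij
    obtain rfl : i = j := by omega
    rfl
  · have hi := isGreatest_stoppingScale hzero
    refine IsGreatest.csSup_eq ⟨hi.1.trans_eq (dyadicMean_eq_of_mem φ le_rfl h).symm,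
      fun s (hs : lam < dyadicMean φ s j) => not_lt.1 fun hlt => hlt.not_ge (hi.2 ?_)⟩
    exact hs.trans_eq (dyadicMean_eq_of_mem φ hlt.le h)

/-- The Calderón–Zygmund partition of `ℤ` for `φ` at height `lam`: its nontrivial cells are
maximal dyadic intervals on which the mean of `φ` exceeds `lam`. -/
def stoppingPartition (φ : ℤ → ℝ≥0∞) (lam : ℝ≥0∞) : CellPartition ℤ where
  cell i := dyadicBlock (stoppingScale φ lam i) i
  mem_cell_iff {i j} := by
    refine ⟨fun h => ?_, fun h => h ▸ self_mem_dyadicBlock _ j⟩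
    rw [stoppingScale_eq_of_mem φ lam h, dyadicBlock_eq_of_mem le_rfl h]

lemma stoppingPartition_isInterval (φ : ℤ → ℝ≥0∞) (lam : ℝ≥0∞) :
    (stoppingPartition φ lam).IsInterval := fun i j h => by
  rw [stoppingPartition, card_dyadicBlock]
  exact natAbs_sub_lt_of_mem_dyadicBlock h

lemma mean_stoppingPartition (φ : ℤ → ℝ≥0∞) (lam : ℝ≥0∞) (i : ℤ) :
    (stoppingPartition φ lam).mean φ i = dyadicMean φ (stoppingScale φ lam i) i := by
  simp only [CellPartition.mean, stoppingPartition, dyadicMean, card_dyadicBlock, Nat.cast_pow,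
    Nat.cast_ofNat]

lemma mean_stoppingPartition_le {φ : ℤ → ℝ≥0∞} (hφ : ∑' i, φ i ≠ ∞) {lam : ℝ≥0∞}
    (h0 : lam ≠ 0) (i : ℤ) : (stoppingPartition φ lam).mean φ i ≤ 2 * lam := by
  rw [mean_stoppingPartition]
  refine (dyadicMean_le_two_mul_succ φ _ i).trans ?_
  gcongr
  exact dyadicMean_succ_stoppingScale_le hφ h0 i

lemma lt_mean_stoppingPartition {φ : ℤ → ℝ≥0∞} {lam : ℝ≥0∞} {i : ℤ}
    (h : 1 < #((stoppingPartition φ lam).cell i)) : lam < (stoppingPartition φ lam).mean φ i := by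
  rw [mean_stoppingPartition]
  refine (isGreatest_stoppingScale fun hzero => h.ne' ?_).1
  rw [stoppingPartition, card_dyadicBlock, hzero, pow_zero]

end DyadicStopping

section WeakTypeInt

/-- `A` bounds the weak type inequality at height `lam`, with respect to counting measure, of the
maximal operator `φ ↦ supₙ ∑ k, K n k φ(· + k)` on `ℤ`. -/
def BoundsMaximalAt {ι : Type*} (K : ι → ℤ → ℝ≥0∞) (lam A : ℝ≥0∞) : Prop :=
  ∀ φ : ℤ → ℝ≥0∞, Measure.count {j | lam < ⨆ n, ∑' k, K n k * φ (j + k)} ≤ A * ∑' i, φ i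

variable {ι : Type*} {D lam : ℝ≥0∞} {K : ι → ℤ → ℝ≥0∞}

lemma tsum_mul_le_of_not_mem_dilate {κ : ℤ → ℝ≥0∞} (hκ1 : ∑' k, κ k ≤ 1)
    (hκ : HasDecayingDifferences D κ) {φ : ℤ → ℝ≥0∞} (hφ : ∑' i, φ i ≠ ∞) (h0 : lam ≠ 0) {j : ℤ}
    (hfar : ∀ i, 1 < #((stoppingPartition φ lam).cell i) →
      2 * #((stoppingPartition φ lam).cell i) ≤ (i - j).natAbs) :
    ∑' k, κ k * φ (j + k) ≤ 2 * lam +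
      D * ∑' i, φ i * regularityTail #((stoppingPartition φ lam).cell i) (i - j) := by
  have hmass : ∑' i, κ (i - j) ≤ 1 := ((Equiv.subRight j).tsum_eq κ).trans_le hκ1
  have hshift : ∑' k, κ k * φ (j + k) = ∑' i, κ (i - j) * φ i := by
    rw [← (Equiv.addLeft j).tsum_eq fun i => κ (i - j) * φ i]
    simp
  rw [hshift]
  refine (hκ.tsum_mul_le (stoppingPartition_isInterval φ lam) φ hfar).trans ?_
  gcongr
  calc ∑' i, κ (i - j) * (stoppingPartition φ lam).mean φ i
      ≤ ∑' i, κ (i - j) * (2 * lam) := by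
        gcongr
        exact mean_stoppingPartition_le hφ h0 _
    _ ≤ 2 * lam := by
        rw [ENNReal.tsum_mul_right]
        exact mul_le_of_le_one_left' hmass

/-- **Calderón–Zygmund weak type `(1, 1)` inequality on `ℤ`.** -/
theorem count_three_mul_lt_iSup_le (hK1 : ∀ n, ∑' k, K n k ≤ 1)
    (hK : ∀ n, HasDecayingDifferences D (K n)) (φ : ℤ → ℝ≥0∞) (h0 : lam ≠ 0) (htop : lam ≠ ∞) :
    Measure.count {j | 3 * lam < ⨆ n, ∑' k, K n k * φ (j + k)} ≤
      (6 + 2 * D) * (∑' i, φ i) / lam := by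
  by_cases hφ : ∑' i, φ i = ∞
  · rw [hφ, ENNReal.mul_top (by simp), ENNReal.top_div_of_ne_top htop]
    exact le_top
  set P := stoppingPartition φ lam
  set B : Set ℤ := {i | lam < P.mean φ i}
  set H : ℤ → ℝ≥0∞ := fun j => D * ∑' i, φ i * regularityTail #(P.cell i) (i - j)
  have hsub : {j | 3 * lam < ⨆ n, ∑' k, K n k * φ (j + k)} ⊆
      {j | ∃ i ∈ B, (i - j).natAbs < 2 * #(P.cell i)} ∪ {j | lam ≤ H j} := by
    refine fun j (hj : 3 * lam < _) => or_iff_not_imp_left.2 fun hnear => ?_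
    have hfar (i : ℤ) (hi : 1 < #(P.cell i)) : 2 * #(P.cell i) ≤ (i - j).natAbs :=
      not_lt.1 fun h => hnear ⟨i, lt_mean_stoppingPartition hi, h⟩
    obtain ⟨n, hn⟩ := lt_iSup_iff.1 hj
    have hle := hn.le.trans (tsum_mul_le_of_not_mem_dilate (hK1 n) (hK n) hφ h0 hfar)
    refine ENNReal.le_of_add_le_add_left (ENNReal.mul_ne_top ENNReal.ofNat_ne_top htop)
      (hle.trans_eq' ?_ : 2 * lam + lam ≤ _)
    ring
  have hB : Measure.count B ≤ (∑' i, φ i) / lam := P.count_lt_mean_le φ h0 htop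
  have hH : Measure.count {j | lam ≤ H j} ≤ D * (2 * ∑' i, φ i) / lam := by
    refine (meas_ge_le_lintegral_div Measurable.of_discrete.aemeasurable h0 htop).trans ?_
    rw [lintegral_count, ENNReal.tsum_mul_left]
    gcongr
    exact tsum_tsum_mul_regularityTail_le P φ
  calc Measure.count {j | 3 * lam < ⨆ n, ∑' k, K n k * φ (j + k)}
      ≤ 6 * Measure.count B + Measure.count {j | lam ≤ H j} :=
        (measure_mono hsub).trans <| (measure_union_le _ _).trans <| by
          gcongr
          exact count_dilate_le (stoppingPartition_isInterval φ lam) fun i hi j hj =>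
            hi.trans_eq (P.mean_eq_of_mem_cell φ hj).symm
    _ ≤ 6 * ((∑' i, φ i) / lam) + D * (2 * ∑' i, φ i) / lam := by gcongr
    _ = (6 + 2 * D) * (∑' i, φ i) / lam := by
        simp only [div_eq_mul_inv]
        ring

lemma boundsMaximalAt_of_hasDecayingDifferences (hK1 : ∀ n, ∑' k, K n k ≤ 1)
    (hK : ∀ n, HasDecayingDifferences D (K n)) (h0 : lam ≠ 0) (htop : lam ≠ ∞) :
    BoundsMaximalAt K lam ((18 + 6 * D) / lam) := by
  intro φ
  have hthird : 3 * (lam / 3) = lam := ENNReal.mul_div_cancel (by simp) (by simp)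
  have h := count_three_mul_lt_iSup_le (lam := lam / 3) hK1 hK φ
    (ENNReal.div_ne_zero.2 ⟨h0, by simp⟩) (ENNReal.div_ne_top htop three_ne_zero)
  rw [hthird] at h
  refine h.trans_eq ?_
  simp only [div_eq_mul_inv]
  rw [ENNReal.mul_inv (by simp) (by simp), inv_inv]
  ring

end WeakTypeInt

section Transference

variable {X : Type*} [MeasurableSpace X]

lemma iter_add (τ : X ≃ᵐ X) (j k : ℤ) (x : X) : iter τ (j + k) x = iter τ k (iter τ j x) := by
  rw [add_comm, iter, zpow_add]
  rfl

lemma measurePreserving_iter {m : Measure X} {τ : X ≃ᵐ X} (hτ : MeasurePreserving τ m m)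
    (k : ℤ) : MeasurePreserving (iter τ k) m m := by
  have hcomp (j k : ℤ) : iter τ (j + k) = iter τ k ∘ iter τ j := funext (iter_add τ j k)
  induction k with
  | zero => exact MeasurePreserving.id m
  | succ n ih =>
    have hone : iter τ 1 = τ := congrArg DFunLike.coe (zpow_one (τ.toEquiv : Equiv.Perm X))
    rw [hcomp, hone]
    exact hτ.comp ih
  | pred n ih =>
    have hneg : iter τ (-1) = τ.symm :=
      congrArg DFunLike.coe (zpow_neg_one (τ.toEquiv : Equiv.Perm X))
    rw [sub_eq_add_neg, hcomp, hneg]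
    exact (hτ.symm τ).comp ih

lemma measurable_comp_iter {m : Measure X} {τ : X ≃ᵐ X} (hτ : MeasurePreserving τ m m)
    {g : X → ℝ≥0∞} (hg : Measurable g) (k : ℤ) : Measurable fun x => g (iter τ k x) :=
  hg.comp (measurePreserving_iter hτ k).measurable

/-- The maximal function `sup_n ∑_{|k| ≤ R} K n k g(τ^k x)` of the kernels truncated at `R`. -/
def truncatedMaximal {ι : Type*} (τ : X ≃ᵐ X) (K : ι → ℤ → ℝ≥0∞) (g : X → ℝ≥0∞) (R : ℕ)
    (x : X) : ℝ≥0∞ :=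
  ⨆ n, ∑ k ∈ Finset.Icc (-(R : ℤ)) R, K n k * g (iter τ k x)

variable {ι : Type*} {m : Measure X} {τ : X ≃ᵐ X} {K : ι → ℤ → ℝ≥0∞} {A lam : ℝ≥0∞}
  {g : X → ℝ≥0∞}

/-- Along an orbit segment of length `L`, the truncated maximal function only sees the values of
`g` on the segment lengthened by `R` at both ends. -/
lemma sum_indicator_orbit_le (hA : BoundsMaximalAt K lam A) (R L : ℕ) (x : X) :
    ∑ j ∈ Ico (0 : ℤ) L, {x | lam < truncatedMaximal τ K g R x}.indicator 1 (iter τ j x) ≤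
      A * ∑ i ∈ Ico (-(R : ℤ)) (L + R), g (iter τ i x) := by
  classical
  set φ : ℤ → ℝ≥0∞ := fun i => if i ∈ Ico (-(R : ℤ)) (L + R) then g (iter τ i x) else 0
  set S : Set ℤ := {j | lam < ⨆ n, ∑' k, K n k * φ (j + k)}
  have horbit : ∀ j ∈ Ico (0 : ℤ) L, iter τ j x ∈ {x | lam < truncatedMaximal τ K g R x} →
      j ∈ S := by
    refine fun j hj (hx : lam < _) => hx.trans_le (iSup_mono fun n => ?_)
    refine (sum_le_sum fun k hk => ?_).trans (ENNReal.sum_le_tsum (Finset.Icc (-(R : ℤ)) R))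
    rw [Finset.mem_Ico] at hj
    rw [Finset.mem_Icc] at hk
    rw [← iter_add]
    exact (congrArg _ (if_pos (Finset.mem_Ico.2 (by omega)))).ge
  calc ∑ j ∈ Ico (0 : ℤ) L, {x | lam < truncatedMaximal τ K g R x}.indicator 1 (iter τ j x)
      ≤ ∑ j ∈ Ico (0 : ℤ) L, S.indicator 1 j := by
        refine sum_le_sum fun j hj => ?_
        by_cases hx : iter τ j x ∈ {x | lam < truncatedMaximal τ K g R x}
        · rw [Set.indicator_of_mem hx, Set.indicator_of_mem (horbit j hj hx)]
          rfl
        · rw [Set.indicator_of_notMem hx]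
          exact zero_le
    _ ≤ Measure.count S := by
        rw [count_eq_tsum_indicator]
        exact ENNReal.sum_le_tsum _
    _ ≤ A * ∑' i, φ i := hA φ
    _ = A * ∑ i ∈ Ico (-(R : ℤ)) (L + R), g (iter τ i x) := by
        rw [tsum_eq_sum fun i hi => if_neg hi, sum_congr rfl fun i hi => if_pos hi]

lemma measurable_truncatedMaximal [Countable ι] (hτ : MeasurePreserving τ m m)
    (hg : Measurable g) (R : ℕ) : Measurable (truncatedMaximal τ K g R) :=
  .iSup fun _ => Finset.measurable_sum _ fun k _ =>
    (measurable_comp_iter hτ hg k).const_mul _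

lemma natCast_mul_measure_lt_truncatedMaximal_le [Countable ι] (hτ : MeasurePreserving τ m m)
    (hA : BoundsMaximalAt K lam A) (hg : Measurable g) (R L : ℕ) :
    L * m {x | lam < truncatedMaximal τ K g R x} ≤ (L + 2 * R) * (A * ∫⁻ x, g x ∂m) := by
  set E := {x | lam < truncatedMaximal τ K g R x}
  have hE : MeasurableSet E :=
    measurableSet_lt measurable_const (measurable_truncatedMaximal hτ hg R)
  have hinv {f : X → ℝ≥0∞} (hf : Measurable f) (s : Finset ℤ) :
      ∫⁻ x, ∑ i ∈ s, f (iter τ i x) ∂m = #s * ∫⁻ x, f x ∂m := by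
    rw [lintegral_finsetSum _ fun i _ => measurable_comp_iter hτ hf i,
      sum_congr rfl fun i _ => (measurePreserving_iter hτ i).lintegral_comp hf, sum_const,
      nsmul_eq_mul]
  have hcard : #(Ico (-(R : ℤ)) (L + R)) = L + 2 * R := by
    rw [Int.card_Ico]
    omega
  calc L * m E = ∫⁻ x, ∑ j ∈ Ico (0 : ℤ) L, E.indicator 1 (iter τ j x) ∂m := by
        rw [hinv (measurable_one.indicator hE), lintegral_indicator_one hE, Int.card_Ico]
        simp
    _ ≤ ∫⁻ x, A * ∑ i ∈ Ico (-(R : ℤ)) (L + R), g (iter τ i x) ∂m :=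
        lintegral_mono fun x => sum_indicator_orbit_le hA R L x
    _ = (L + 2 * R) * (A * ∫⁻ x, g x ∂m) := by
        rw [lintegral_const_mul _ (Finset.measurable_sum _ fun i _ => measurable_comp_iter hτ hg i),
          hinv hg, hcard]
        push_cast
        ring

lemma le_of_forall_natCast_mul_le {a b c : ℝ≥0∞} (hc : c ≠ ∞)
    (h : ∀ L : ℕ, L * a ≤ (L + c) * b) : a ≤ b := by
  rcases eq_or_ne b ∞ with rfl | hb
  · exact le_top
  refine ENNReal.le_of_forall_pos_le_add fun ε hε _ => ?_
  obtain ⟨L, hL⟩ := ENNReal.exists_nat_mul_gt (a := (ε : ℝ≥0∞)) (b := c * b)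
    (by exact_mod_cast hε.ne') (ENNReal.mul_ne_top hc hb)
  have hL0 : (L : ℝ≥0∞) ≠ 0 := by
    rintro hzero
    simp [hzero] at hL
  rw [← ENNReal.mul_le_mul_iff_right hL0 (ENNReal.natCast_ne_top L)]
  calc L * a ≤ L * b + c * b := (h L).trans_eq (add_mul _ _ _)
    _ ≤ L * b + L * ε := by gcongr
    _ = L * (b + ε) := (mul_add _ _ _).symm

lemma monotone_truncatedMaximal (τ : X ≃ᵐ X) (K : ι → ℤ → ℝ≥0∞) (g : X → ℝ≥0∞) :
    Monotone (truncatedMaximal τ K g) := fun R S hRS x => by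
  refine iSup_mono fun n => sum_le_sum_of_subset (Icc_subset_Icc ?_ ?_) <;> simpa using hRS

lemma iSup_tsum_le_iSup_truncatedMaximal (τ : X ≃ᵐ X) (K : ι → ℤ → ℝ≥0∞) (g : X → ℝ≥0∞)
    (x : X) : ⨆ n, ∑' k, K n k * g (iter τ k x) ≤ ⨆ R, truncatedMaximal τ K g R x := by
  refine iSup_le fun n => ?_
  rw [ENNReal.tsum_eq_iSup_sum]
  refine iSup_le fun s => ?_
  set R : ℕ := s.sup Int.natAbs
  have hs : s ⊆ Finset.Icc (-(R : ℤ)) R := fun k hk => by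
    have hkR : k.natAbs ≤ R := le_sup (f := Int.natAbs) hk
    rw [Finset.mem_Icc]
    omega
  calc ∑ k ∈ s, K n k * g (iter τ k x)
      ≤ ∑ k ∈ Finset.Icc (-(R : ℤ)) R, K n k * g (iter τ k x) := sum_le_sum_of_subset hs
    _ ≤ truncatedMaximal τ K g R x :=
        le_iSup (fun n => ∑ k ∈ Finset.Icc (-(R : ℤ)) R, K n k * g (iter τ k x)) n
    _ ≤ ⨆ R, truncatedMaximal τ K g R x := le_iSup (fun R => truncatedMaximal τ K g R x) R

/-- **Calderón's transference principle.** -/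
theorem measure_lt_iSup_tsum_le [Countable ι] (hτ : MeasurePreserving τ m m)
    (hA : BoundsMaximalAt K lam A) (hg : AEMeasurable g m) :
    m {x | lam < ⨆ n, ∑' k, K n k * g (iter τ k x)} ≤ A * ∫⁻ x, g x ∂m := by
  have horbit : ∀ᵐ x ∂m, ∀ k, g (iter τ k x) = hg.mk g (iter τ k x) := ae_all_iff.2 fun k =>
    (measurePreserving_iter hτ k).quasiMeasurePreserving.ae_eq_comp hg.ae_eq_mk
  have hlevel : Monotone fun R => {x | lam < truncatedMaximal τ K (hg.mk g) R x} :=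
    fun R S hRS x hx => hx.trans_le (monotone_truncatedMaximal τ K _ hRS x)
  calc m {x | lam < ⨆ n, ∑' k, K n k * g (iter τ k x)}
      ≤ m (⋃ R, {x | lam < truncatedMaximal τ K (hg.mk g) R x}) := by
        refine measure_mono_ae ?_
        filter_upwards [horbit] with x hx (hlt : lam < _)
        simp only [hx] at hlt
        exact Set.mem_iUnion.2
          (lt_iSup_iff.1 (hlt.trans_le (iSup_tsum_le_iSup_truncatedMaximal τ K _ x)))
    _ = ⨆ R, m {x | lam < truncatedMaximal τ K (hg.mk g) R x} := hlevel.measure_iUnion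
    _ ≤ A * ∫⁻ x, hg.mk g x ∂m := iSup_le fun R =>
        le_of_forall_natCast_mul_le (by finiteness) fun L =>
          natCast_mul_measure_lt_truncatedMaximal_le hτ hA hg.measurable_mk R L
    _ = A * ∫⁻ x, g x ∂m := by rw [lintegral_congr_ae hg.ae_eq_mk]

end Transference

section MaximalOperator

variable {X : Type*} [MeasurableSpace X] {m : Measure X} {τ : X ≃ᵐ X} {μ : ℕ → Measure ℤ}

lemma enorm_average_le (τ : X ≃ᵐ X) (μ : Measure ℤ) [IsFiniteMeasure μ] (f : X → ℝ) (x : X) :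
    ‖average τ μ f x‖ₑ ≤ ∑' k, μ {k} * ‖f (iter τ k x)‖ₑ := by
  refine enorm_tsum_le_tsum_enorm.trans_eq (tsum_congr fun k => ?_)
  rw [enorm_mul, Real.enorm_eq_ofReal measureReal_nonneg, ofReal_measureReal]

lemma maximal_le_iSup (τ : X ≃ᵐ X) (hμ : ∀ n, 1 ≤ n → IsFiniteMeasure (μ n)) (f : X → ℝ) (x : X) :
    maximal τ μ f x ≤ ⨆ n : {n // 1 ≤ n}, ∑' k, μ n {k} * ‖f (iter τ k x)‖ₑ := by
  refine iSup₂_le fun n hn => ?_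
  have := hμ n hn
  rw [← Real.enorm_eq_ofReal_abs]
  exact (enorm_average_le τ (μ n) f x).trans
    (le_iSup (fun n : {n // 1 ≤ n} => ∑' k, μ n {k} * ‖f (iter τ k x)‖ₑ) ⟨n, hn⟩)

lemma weakType11_of_forall_le {T : (X → ℝ) → X → ℝ≥0∞} {C : ℝ≥0} (hC : 0 < C)
    (h : ∀ f, AEMeasurable f m → ∀ lam : ℝ≥0∞, lam ≠ 0 → lam ≠ ∞ →
      m {x | lam < T f x} ≤ C / lam * ∫⁻ x, ‖f x‖ₑ ∂m) : WeakType11 m T := by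
  refine ⟨C, hC, fun f hf lam hlam => ?_⟩
  refine (h f hf.aemeasurable _ (by simpa using hlam) ENNReal.ofReal_ne_top).trans_eq ?_
  rw [ENNReal.ofReal_mul (by positivity), ENNReal.ofReal_div_of_pos hlam, ENNReal.ofReal_coe_nnreal,
    ← ofReal_integral_norm_eq_lintegral_enorm hf]
  rfl

/-- **Bellow–Calderón criterion.** -/
theorem weakType11_maximal (hτ : MeasurePreserving τ m m)
    (hμ : ∀ n, 1 ≤ n → IsProbabilityMeasure (μ n)) {D : ℝ≥0}
    (hD : ∀ n, 1 ≤ n → HasDecayingDifferences D fun k => μ n {k}) :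
    WeakType11 m (maximal τ μ) := by
  have hmass (n : {n // 1 ≤ n}) : ∑' k, μ n {k} ≤ 1 := by
    have := hμ n n.2
    simpa using (lintegral_countable' (μ := μ n) fun _ => (1 : ℝ≥0∞)).ge
  have hfin : ∀ n, 1 ≤ n → IsFiniteMeasure (μ n) := fun n hn =>
    have := hμ n hn
    inferInstance
  refine weakType11_of_forall_le (C := 18 + 6 * D) (by positivity) fun f hf lam h0 htop => ?_
  have hbounds := boundsMaximalAt_of_hasDecayingDifferences hmass (fun n => hD n n.2) h0 htop
  have htransfer := measure_lt_iSup_tsum_le hτ hbounds hf.enorm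
  push_cast
  exact (measure_mono fun x (hx : lam < _) => hx.trans_le (maximal_le_iSup τ hfin f x)).trans
    htransfer

end MaximalOperator

section FourierTransform

open Real (pi)
open scoped Real FourierTransform

variable {ν : Measure ℤ}

lemma norm_fourierChar_sub_le (a b : ℝ) : ‖(𝐞 a : ℂ) - 𝐞 b‖ ≤ 2 * π * |a - b| := by
  have hfactor : (𝐞 a : ℂ) - 𝐞 b =
      𝐞 b * (Complex.exp (Complex.I * (2 * π * (a - b) : ℝ)) - 1) := by
    simp only [Real.fourierChar_apply, mul_sub, mul_one, ← Complex.exp_add]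
    congr 2
    push_cast
    ring
  rw [hfactor, norm_mul, Circle.norm_coe, one_mul]
  refine Real.norm_exp_I_mul_ofReal_sub_one_le.trans_eq ?_
  rw [Real.norm_eq_abs, abs_mul, abs_of_pos Real.two_pi_pos]

lemma intervalIntegral_fourierChar (j : ℤ) :
    ∫ t in (-(1 / 2) : ℝ)..(1 / 2), (𝐞 (j * t) : ℂ) = if j = 0 then 1 else 0 := by
  split_ifs with h
  · norm_num [h]
  · have hc : (2 * π * Complex.I * j : ℂ) ≠ 0 := by simp [Real.pi_ne_zero, h]
    have hexp (t : ℝ) : (𝐞 (j * t) : ℂ) = Complex.exp (2 * π * Complex.I * j * t) := by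
      rw [Real.fourierChar_apply]
      push_cast
      ring_nf
    simp_rw [hexp]
    rw [integral_exp_mul_complex hc, div_eq_zero_iff, sub_eq_zero,
      Complex.exp_eq_exp_iff_exists_int]
    exact .inl ⟨j, by push_cast; ring⟩

lemma fourier_eq_charFun (ν : Measure ℤ) [IsFiniteMeasure ν] :
    fourier ν = charFun (ν.map fun k : ℤ => 2 * π * k) := by
  ext t
  rw [charFun_apply_real, integral_map (by fun_prop) (by fun_prop), integral_countable]
  · refine tsum_congr fun k => ?_
    rw [Complex.real_smul]
    push_cast
    ring_nf
  · refine .of_bound (by fun_prop) 1 (ae_of_all _ fun k => ?_)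
    exact_mod_cast (Complex.norm_exp_ofReal_mul_I (t * (2 * π * k))).le

lemma fourier_conv (μ ν : Measure ℤ) [IsFiniteMeasure μ] [IsFiniteMeasure ν] :
    fourier (μ.conv ν) = fourier μ * fourier ν := by
  have hmap : (μ.conv ν).map (fun k : ℤ => 2 * π * k) =
      (μ.map fun k : ℤ => 2 * π * k).conv (ν.map fun k : ℤ => 2 * π * k) :=
    Measure.map_conv_addMonoidHom ((AddMonoidHom.mulLeft (2 * π)).comp (Int.castAddHom ℝ))
      (measurable_of_countable _)
  ext t
  simp only [fourier_eq_charFun, hmap, charFun_conv, Pi.mul_apply]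

lemma norm_fourier_le_one [IsProbabilityMeasure ν] (t : ℝ) : ‖fourier ν t‖ ≤ 1 := by
  have := Measure.isProbabilityMeasure_map (μ := ν) (f := fun k : ℤ => 2 * π * k) (by fun_prop)
  rw [fourier_eq_charFun]
  exact norm_charFun_le_one t

lemma memLp_id_map {p : ℝ≥0∞} (h : MemLp ((↑) : ℤ → ℝ) p ν) :
    MemLp id p (ν.map fun k : ℤ => 2 * π * k) :=
  (memLp_map_measure_iff (by fun_prop) (by fun_prop)).2 (h.const_mul (2 * π))

lemma contDiff_fourier [IsFiniteMeasure ν] {n : ℕ} (h : MemLp ((↑) : ℤ → ℝ) n ν) :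
    ContDiff ℝ n (fourier ν) := by
  rw [fourier_eq_charFun]
  exact contDiff_charFun (memLp_id_map h)

lemma iteratedDeriv_fourier [IsFiniteMeasure ν] {n : ℕ} (h : MemLp ((↑) : ℤ → ℝ) n ν) (t : ℝ) :
    iteratedDeriv n (fourier ν) t = ∫ k : ℤ, (2 * π * Complex.I * k) ^ n * 𝐞 (k * t) ∂ν := by
  rw [fourier_eq_charFun, iteratedDeriv_charFun (memLp_id_map h),
    integral_map (by fun_prop) (by fun_prop), ← integral_const_mul]
  refine integral_congr_ae (ae_of_all _ fun k => ?_)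
  simp only [Real.fourierChar_apply]
  push_cast
  rw [← mul_assoc, ← mul_pow]
  ring_nf

lemma secondMoment_eq_lintegral (ν : Measure ℤ) :
    secondMoment ν = ∫⁻ k : ℤ, ‖(k : ℝ)‖ₑ ^ 2 ∂ν := by
  rw [lintegral_countable', secondMoment]
  simp only [ENNReal.ofReal_pow (abs_nonneg _), Real.enorm_eq_ofReal_abs]

lemma memLp_two_intCast (h : secondMoment ν ≠ ∞) : MemLp ((↑) : ℤ → ℝ) 2 ν := by
  refine ⟨by fun_prop, ?_⟩
  rw [eLpNorm_lt_top_iff_lintegral_rpow_enorm_lt_top two_ne_zero ENNReal.ofNat_ne_top]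
  simpa [secondMoment_eq_lintegral, lt_top_iff_ne_top] using h

lemma memLp_intCast_conv {p : ℝ≥0∞} {μ : Measure ℤ} [IsFiniteMeasure μ] [IsFiniteMeasure ν]
    (hμ : MemLp ((↑) : ℤ → ℝ) p μ) (hν : MemLp ((↑) : ℤ → ℝ) p ν) :
    MemLp ((↑) : ℤ → ℝ) p (μ.conv ν) := by
  rw [Measure.conv, memLp_map_measure_iff (by fun_prop) (by fun_prop)]
  refine ((hμ.comp_fst ν).add (hν.comp_snd μ)).congr_norm (by fun_prop) ?_
  exact ae_of_all _ fun k => by simp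

lemma norm_iteratedDeriv_fourier_le [IsFiniteMeasure ν] {n : ℕ} (h : MemLp ((↑) : ℤ → ℝ) n ν)
    (t : ℝ) : ‖iteratedDeriv n (fourier ν) t‖ ≤ (2 * π) ^ n * ∫ k : ℤ, |(k : ℝ)| ^ n ∂ν := by
  rw [iteratedDeriv_fourier h, ← integral_const_mul]
  refine (norm_integral_le_integral_norm _).trans_eq (integral_congr_ae (ae_of_all _ fun k => ?_))
  simp [mul_pow, abs_of_pos Real.pi_pos, Circle.norm_coe]

lemma toReal_secondMoment (ν : Measure ℤ) :
    (secondMoment ν).toReal = ∫ k : ℤ, |(k : ℝ)| ^ 2 ∂ν := by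
  rw [secondMoment_eq_lintegral, ← integral_toReal (by fun_prop) (by simp)]
  simp

lemma norm_iteratedDeriv_two_fourier_le [IsFiniteMeasure ν] (h : MemLp ((↑) : ℤ → ℝ) 2 ν) (t : ℝ) :
    ‖iteratedDeriv 2 (fourier ν) t‖ ≤ (2 * π) ^ 2 * (secondMoment ν).toReal := by
  rw [toReal_secondMoment]
  exact norm_iteratedDeriv_fourier_le h t

lemma deriv_fourier_zero [IsFiniteMeasure ν] (h : MemLp ((↑) : ℤ → ℝ) 1 ν) :
    deriv (fourier ν) 0 = 2 * π * Complex.I * expectation ν := by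
  have hint : expectation ν = ∫ k : ℤ, (k : ℝ) ∂ν := by
    rw [integral_countable (memLp_one_iff_integrable.1 h), expectation]
    simp only [smul_eq_mul, mul_comm]
  rw [← iteratedDeriv_one, iteratedDeriv_fourier (by simpa using h), hint,
    ← integral_complex_ofReal, ← integral_const_mul]
  simp

lemma norm_deriv_fourier_le [IsFiniteMeasure ν] (h : MemLp ((↑) : ℤ → ℝ) 2 ν)
    (hexp : expectation ν = 0) (t : ℝ) :
    ‖deriv (fourier ν) t‖ ≤ (2 * π) ^ 2 * (secondMoment ν).toReal * |t| := by
  have hdiff : Differentiable ℝ (deriv (fourier ν)) := by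
    simpa using (contDiff_fourier (n := 2) h).differentiable_iteratedDeriv 1 (by norm_num)
  have hbound (x : ℝ) : ‖deriv (deriv (fourier ν)) x‖ ≤ (2 * π) ^ 2 * (secondMoment ν).toReal := by
    simpa only [iteratedDeriv_succ, iteratedDeriv_zero]
      using norm_iteratedDeriv_two_fourier_le h x
  have hzero : deriv (fourier ν) 0 = 0 := by
    simp [deriv_fourier_zero (h.mono_exponent one_le_two), hexp]
  simpa [hzero] using convex_univ.norm_image_sub_le_of_norm_deriv_le
    (fun x _ => hdiff x) (fun x _ => hbound x) (Set.mem_univ 0) (Set.mem_univ t)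

lemma integral_iteratedDeriv_fourier_mul [IsFiniteMeasure ν] {n : ℕ}
    (h : MemLp ((↑) : ℤ → ℝ) n ν) (x : ℤ) :
    ∫ t in (-(1 / 2) : ℝ)..(1 / 2), iteratedDeriv n (fourier ν) t * 𝐞 (-(x * t)) =
      (2 * π * Complex.I * x) ^ n * ν.real {x} := by
  have hterm (k : ℤ) (t : ℝ) : (2 * π * Complex.I * k) ^ n * 𝐞 (k * t) * (𝐞 (-(x * t)) : ℂ) =
      (2 * π * Complex.I * k) ^ n * 𝐞 ((k - x : ℤ) * t) := by
    rw [mul_assoc, ← Circle.coe_mul, ← AddChar.map_add_eq_mul]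
    push_cast
    ring_nf
  have hint : Integrable (fun p : ℝ × ℤ => (2 * π * Complex.I * p.2) ^ n *
      (𝐞 ((p.2 - x : ℤ) * p.1) : ℂ))
      ((volume.restrict (Set.uIoc (-(1 / 2)) (1 / 2))).prod ν) := by
    rw [Set.uIoc_of_le (by norm_num)]
    refine ((h.integrable_norm_pow'.const_mul ((2 * π) ^ n)).comp_snd _).mono' (by fun_prop)
      (ae_of_all _ fun p => ?_)
    simp [mul_pow, abs_of_pos Real.pi_pos, Circle.norm_coe]
  simp_rw [iteratedDeriv_fourier h, ← integral_mul_const, hterm]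
  rw [intervalIntegral_integral_swap hint]
  have hsingle (k : ℤ) : (2 * π * Complex.I * k) ^ n * (if k - x = 0 then 1 else 0) =
      ({x} : Set ℤ).indicator (fun k : ℤ => (2 * π * Complex.I * k) ^ n) k := by
    simp [Set.indicator_apply, sub_eq_zero]
  simp_rw [intervalIntegral.integral_const_mul, intervalIntegral_fourierChar, hsingle]
  rw [integral_indicator (measurableSet_singleton x), integral_singleton, Complex.real_smul,
    mul_comm]

lemma abs_pow_mul_sub_le [IsFiniteMeasure ν] {n : ℕ} (h : MemLp ((↑) : ℤ → ℝ) n ν) (x y : ℤ) :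
    (2 * π) ^ n * |(x : ℝ) ^ n * ν.real {x} - (y : ℝ) ^ n * ν.real {y}| ≤
      2 * π * |(x : ℝ) - y| *
        ∫ t in (-(1 / 2) : ℝ)..(1 / 2), ‖iteratedDeriv n (fourier ν) t‖ * |t| := by
  have hcont : Continuous (iteratedDeriv n (fourier ν)) :=
    (contDiff_fourier h).continuous_iteratedDeriv n le_rfl
  have hint (z : ℤ) : IntervalIntegrable
      (fun t : ℝ => iteratedDeriv n (fourier ν) t * (𝐞 (-(z * t)) : ℂ)) volume (-(1 / 2)) (1 / 2) :=
    Continuous.intervalIntegrable (by fun_prop) _ _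
  have hinv : ∫ t in (-(1 / 2) : ℝ)..(1 / 2), iteratedDeriv n (fourier ν) t *
      ((𝐞 (-(x * t)) : ℂ) - 𝐞 (-(y * t))) =
      (2 * π * Complex.I) ^ n *
        ((x : ℝ) ^ n * ν.real {x} - (y : ℝ) ^ n * ν.real {y} : ℝ) := by
    simp_rw [mul_sub]
    rw [intervalIntegral.integral_sub (hint x) (hint y), integral_iteratedDeriv_fourier_mul h,
      integral_iteratedDeriv_fourier_mul h]
    push_cast
    ring
  have hnorm : ‖(2 * π * Complex.I : ℂ) ^ n‖ = (2 * π) ^ n := by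
    simp [abs_of_pos Real.pi_pos]
  rw [← hnorm, ← Real.norm_eq_abs (_ - _ : ℝ), ← Complex.norm_real, ← norm_mul, ← hinv,
    ← intervalIntegral.integral_const_mul]
  refine intervalIntegral.norm_integral_le_of_norm_le (by norm_num) (ae_of_all _ fun t _ => ?_)
    (Continuous.intervalIntegrable (by fun_prop) _ _)
  calc ‖iteratedDeriv n (fourier ν) t * ((𝐞 (-(x * t)) : ℂ) - 𝐞 (-(y * t)))‖
      ≤ ‖iteratedDeriv n (fourier ν) t‖ * (2 * π * |-(x * t) - -(y * t)|) := by
        rw [norm_mul]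
        gcongr
        exact norm_fourierChar_sub_le _ _
    _ = 2 * π * |(x : ℝ) - y| * (‖iteratedDeriv n (fourier ν) t‖ * |t|) := by
        rw [show -(x * t) - -(y * t) = -((x - y) * t) by ring, abs_neg, abs_mul]
        ring

lemma sq_mul_sub_le {w : ℤ → ℝ} (hw : ∀ x, 0 ≤ w x) {J : ℝ}
    (hJ : ∀ x y : ℤ, |(x : ℝ) ^ 2 * w x - (y : ℝ) ^ 2 * w y| ≤ J * |(x : ℝ) - y|) {x y : ℤ}
    (hxy : 2 * |(x : ℝ) - y| ≤ |(x : ℝ)|) :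
    (x : ℝ) ^ 2 * (w x - w y) ≤ 4 * J * |(x : ℝ) - y| := by
  rcases eq_or_ne y 0 with rfl | hy
  · obtain rfl : x = 0 := by
      rw [← Int.cast_eq_zero (α := ℝ), ← abs_nonpos_iff]
      simp only [Int.cast_zero, sub_zero] at hxy
      linarith
    simp
  have hy0 : 0 < |(y : ℝ)| := by simpa using hy
  have hxy3 : |(x : ℝ) + y| ≤ 3 * |(y : ℝ)| := by
    linarith [abs_add_le (x : ℝ) y, abs_sub_abs_le_abs_sub (x : ℝ) y]
  have hdecay : |(y : ℝ)| * w y ≤ J := by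
    refine le_of_mul_le_mul_left ?_ hy0
    calc |(y : ℝ)| * (|(y : ℝ)| * w y) = (y : ℝ) ^ 2 * w y := by rw [← sq_abs (y : ℝ)]; ring
      _ ≤ |(y : ℝ)| * J := by
          simpa [mul_comm J] using (le_abs_self _).trans (hJ y 0)
  have hsq : ((y : ℝ) ^ 2 - x ^ 2) * w y ≤ 3 * J * |(x : ℝ) - y| := by
    calc ((y : ℝ) ^ 2 - x ^ 2) * w y ≤ |(x : ℝ) - y| * |(x : ℝ) + y| * w y := by
          gcongr
          · exact hw y
          · rw [← abs_mul, mul_comm, ← sq_sub_sq, abs_sub_comm]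
            exact le_abs_self _
      _ ≤ |(x : ℝ) - y| * (3 * |(y : ℝ)|) * w y := by gcongr; exact hw y
      _ = 3 * (|(y : ℝ)| * w y) * |(x : ℝ) - y| := by ring
      _ ≤ _ := by gcongr
  linarith [le_of_abs_le (hJ x y)]

lemma abs_sq_mul_sub_le [IsFiniteMeasure ν] (h : MemLp ((↑) : ℤ → ℝ) 2 ν) {J : ℝ}
    (hJ : ∫ t in (-(1 / 2) : ℝ)..(1 / 2), ‖iteratedDeriv 2 (fourier ν) t‖ * |t| ≤ J) (x y : ℤ) :
    |(x : ℝ) ^ 2 * ν.real {x} - (y : ℝ) ^ 2 * ν.real {y}| ≤ J * |(x : ℝ) - y| := by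
  have hpi : 1 ≤ 2 * π := by linarith [Real.pi_gt_three]
  refine le_of_mul_le_mul_left ?_ Real.two_pi_pos
  calc 2 * π * |(x : ℝ) ^ 2 * ν.real {x} - (y : ℝ) ^ 2 * ν.real {y}|
      ≤ (2 * π) ^ 2 * |(x : ℝ) ^ 2 * ν.real {x} - (y : ℝ) ^ 2 * ν.real {y}| := by
        gcongr
        exact le_self_pow₀ hpi two_ne_zero
    _ ≤ 2 * π * |(x : ℝ) - y| *
          ∫ t in (-(1 / 2) : ℝ)..(1 / 2), ‖iteratedDeriv 2 (fourier ν) t‖ * |t| :=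
        abs_pow_mul_sub_le h x y
    _ ≤ 2 * π * |(x : ℝ) - y| * J := by gcongr
    _ = 2 * π * (J * |(x : ℝ) - y|) := by ring

lemma hasDecayingDifferences_of_integral_le [IsFiniteMeasure ν] (h : MemLp ((↑) : ℤ → ℝ) 2 ν)
    {J : ℝ} (hJ : ∫ t in (-(1 / 2) : ℝ)..(1 / 2), ‖iteratedDeriv 2 (fourier ν) t‖ * |t| ≤ J) :
    HasDecayingDifferences (4 * J).toNNReal fun k => ν {k} := by
  intro x y hxy
  have hJ0 : 0 ≤ J := by
    refine (intervalIntegral.integral_nonneg (by norm_num) fun t _ => ?_).trans hJ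
    positivity
  rcases eq_or_ne x 0 with rfl | hx
  · obtain rfl : y = 0 := by simpa using hxy
    exact le_self_add
  have hxy_real : 2 * |(x : ℝ) - y| ≤ |(x : ℝ)| := by
    have := Nat.cast_le (α := ℝ).2 hxy
    simpa using this
  have hreal : ν.real {x} ≤ ν.real {y} + 4 * J * (|(x : ℝ) - y| / |(x : ℝ)| ^ 2) := by
    have hsq := sq_mul_sub_le (fun _ => measureReal_nonneg) (abs_sq_mul_sub_le h hJ) hxy_real
    rw [← sub_le_iff_le_add', ← mul_div_assoc, le_div_iff₀' (by positivity), sq_abs]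
    exact hsq
  have hcast (z : ℤ) : ENNReal.ofReal |(z : ℝ)| = z.natAbs := by
    rw [← ENNReal.ofReal_natCast, Nat.cast_natAbs, Int.cast_abs]
  calc ν {x} = ENNReal.ofReal (ν.real {x}) := (ofReal_measureReal).symm
    _ ≤ ENNReal.ofReal (ν.real {y} + 4 * J * (|((x - y : ℤ) : ℝ)| / |(x : ℝ)| ^ 2)) := by
        push_cast
        exact ENNReal.ofReal_le_ofReal hreal
    _ = ν {y} + (4 * J).toNNReal * ((x - y).natAbs / (x.natAbs : ℝ≥0∞) ^ 2) := by
        rw [ENNReal.ofReal_add measureReal_nonneg (by positivity), ofReal_measureReal,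
          ENNReal.ofReal_mul (by positivity), ENNReal.ofReal_div_of_pos (by positivity),
          ENNReal.ofReal_pow (abs_nonneg _), hcast, hcast]
        rfl

end FourierTransform

section ProductDerivatives

lemma norm_prod_le_prod {ι R : Type*} [NormedCommRing R] [NormOneClass R] {u : Finset ι}
    {z : ι → R} {b : ι → ℝ} (h : ∀ i ∈ u, ‖z i‖ ≤ b i) : ‖∏ i ∈ u, z i‖ ≤ ∏ i ∈ u, b i :=
  (Finset.norm_prod_le _ _).trans (prod_le_prod (fun _ _ => norm_nonneg _) h)

variable {ι 𝕜 R : Type*} [NontriviallyNormedField 𝕜] [NormedCommRing R] [NormedAlgebra 𝕜 R]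
  {u : Finset ι} {f : ι → 𝕜 → R} {x : 𝕜} {a b c : ι → ℝ}

lemma norm_iteratedDeriv_two_mul_le {g h : 𝕜 → R} (hg : ContDiffAt 𝕜 2 g x)
    (hh : ContDiffAt 𝕜 2 h x) :
    ‖iteratedDeriv 2 (g * h) x‖ ≤
      ‖iteratedDeriv 2 g x‖ * ‖h x‖ + 2 * (‖deriv g x‖ * ‖deriv h x‖) +
        ‖g x‖ * ‖iteratedDeriv 2 h x‖ := by
  have hleibniz : iteratedDeriv 2 (g * h) x =
      iteratedDeriv 2 g x * h x + (deriv g x * deriv h x + deriv g x * deriv h x) +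
        g x * iteratedDeriv 2 h x := by
    rw [iteratedDeriv_mul (n := 2) hg hh]
    simp only [sum_range_succ, sum_range_zero, iteratedDeriv_zero, iteratedDeriv_one,
      Nat.choose_zero_right, Nat.choose_one_right, Nat.choose_self, Nat.reduceSub, Nat.reduceAdd,
      Nat.cast_one, Nat.cast_ofNat]
    ring
  rw [hleibniz, two_mul]
  refine norm_add₃_le.trans (add_le_add_three (norm_mul_le _ _) ?_ (norm_mul_le _ _))
  exact norm_add_le_of_le (norm_mul_le _ _) (norm_mul_le _ _)

variable [NormOneClass R]

lemma norm_deriv_prod_le (hf : ∀ i ∈ u, DifferentiableAt 𝕜 (f i) x) (h0 : ∀ i ∈ u, ‖f i x‖ ≤ b i)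
    (h1 : ∀ i ∈ u, ‖deriv (f i) x‖ ≤ a i * b i) :
    ‖deriv (∏ i ∈ u, f i) x‖ ≤ (∑ i ∈ u, a i) * ∏ i ∈ u, b i := by
  classical
  rw [deriv_finsetProd hf, sum_mul]
  refine norm_sum_le_of_le u fun i hi => ?_
  have herase : ∀ j ∈ u.erase i, ‖f j x‖ ≤ b j := fun j hj => h0 j (mem_of_mem_erase hj)
  calc ‖(∏ j ∈ u.erase i, f j x) • deriv (f i) x‖
      ≤ (∏ j ∈ u.erase i, b j) * (a i * b i) :=
        norm_mul_le_of_le (norm_prod_le_prod herase) (h1 i hi)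
    _ = a i * ∏ j ∈ u, b j := by rw [← mul_prod_erase u b hi]; ring

lemma norm_iteratedDeriv_two_prod_le (hf : ∀ i ∈ u, ContDiffAt 𝕜 2 (f i) x)
    (h0 : ∀ i ∈ u, ‖f i x‖ ≤ b i) (h1 : ∀ i ∈ u, ‖deriv (f i) x‖ ≤ a i * b i)
    (h2 : ∀ i ∈ u, ‖iteratedDeriv 2 (f i) x‖ ≤ c i * b i) :
    ‖iteratedDeriv 2 (∏ i ∈ u, f i) x‖ ≤
      (∑ i ∈ u, c i + (∑ i ∈ u, a i) ^ 2) * ∏ i ∈ u, b i := by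
  classical
  induction u using Finset.induction_on with
  | empty => simp [Pi.one_def, iteratedDeriv_const]
  | insert i u hi ih =>
    simp only [forall_mem_insert] at hf h0 h1 h2
    have hprod : ‖(∏ j ∈ u, f j) x‖ ≤ ∏ j ∈ u, b j := by
      rw [Finset.prod_apply]
      exact norm_prod_le_prod h0.2
    have hderiv := norm_deriv_prod_le (fun j hj => (hf.2 j hj).differentiableAt two_ne_zero)
      h0.2 h1.2
    specialize ih hf.2 h0.2 h1.2 h2.2
    have hP : 0 ≤ b i * ∏ j ∈ u, b j :=
      mul_nonneg ((norm_nonneg _).trans h0.1) ((norm_nonneg _).trans hprod)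
    rw [prod_insert hi, prod_insert hi, sum_insert hi, sum_insert hi]
    calc ‖iteratedDeriv 2 (f i * ∏ j ∈ u, f j) x‖
        ≤ (c i * b i) * ∏ j ∈ u, b j + 2 * ((a i * b i) * ((∑ j ∈ u, a j) * ∏ j ∈ u, b j)) +
            b i * ((∑ j ∈ u, c j + (∑ j ∈ u, a j) ^ 2) * ∏ j ∈ u, b j) := by
          refine (norm_iteratedDeriv_two_mul_le hf.1 (contDiffAt_prod' hf.2)).trans ?_
          gcongr
          exacts [(norm_nonneg _).trans h2.1, h2.1, (norm_nonneg _).trans h1.1, h1.1,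
            (norm_nonneg _).trans h0.1, h0.1]
      _ = (c i + ∑ j ∈ u, c j + (a i + ∑ j ∈ u, a j) ^ 2) * (b i * ∏ j ∈ u, b j) -
            a i ^ 2 * (b i * ∏ j ∈ u, b j) := by ring
      _ ≤ _ := sub_le_self _ (mul_nonneg (sq_nonneg _) hP)

end ProductDerivatives

section GaussianMoments

open Real

lemma integral_abs_pow_mul_exp_neg_mul_sq {a : ℝ} (ha : 0 < a) (k : ℕ) :
    ∫ t : ℝ, |t| ^ (2 * k + 1) * exp (-a * t ^ 2) = k.factorial / a ^ (k + 1) := by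
  have hexp : ((2 * k + 1 : ℕ) + 1 : ℝ) / 2 = k + 1 := by push_cast; ring
  have hIoi : ∫ t in Set.Ioi (0 : ℝ), t ^ (2 * k + 1) * exp (-a * t ^ 2) =
      a ^ (-(k + 1) : ℝ) * (1 / 2) * k.factorial := by
    have h := integral_rpow_mul_exp_neg_mul_rpow (p := 2) (q := (2 * k + 1 : ℕ)) two_pos
      (neg_one_lt_zero.trans_le (Nat.cast_nonneg _)) ha
    rw [neg_div, hexp, Gamma_nat_eq_factorial] at h
    rw [← h]
    simp only [rpow_natCast, rpow_ofNat]
  have habs := integral_comp_abs (f := fun t : ℝ => t ^ (2 * k + 1) * exp (-a * t ^ 2))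
  simp only [sq_abs] at habs
  rw [habs, hIoi, rpow_neg ha.le, ← Nat.cast_succ, rpow_natCast]
  field_simp

lemma intervalIntegral_abs_pow_mul_exp_neg_mul_sq_le {a b c : ℝ} (ha : 0 < a) (hbc : b ≤ c)
    (k : ℕ) :
    ∫ t in b..c, |t| ^ (2 * k + 1) * exp (-a * t ^ 2) ≤ k.factorial / a ^ (k + 1) := by
  have hint : Integrable fun t : ℝ => |t| ^ (2 * k + 1) * exp (-a * t ^ 2) := by
    have h := (integrable_rpow_mul_exp_neg_mul_sq ha (s := (2 * k + 1 : ℕ))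
      (neg_one_lt_zero.trans_le (Nat.cast_nonneg _))).norm
    simpa only [rpow_natCast, norm_mul, norm_pow, norm_eq_abs, abs_exp] using h
  rw [intervalIntegral.integral_of_le hbc, ← integral_abs_pow_mul_exp_neg_mul_sq ha]
  exact setIntegral_le_integral hint (ae_of_all _ fun t => by positivity)

end GaussianMoments

section LinearGrowth

variable {a : ℕ → ℝ≥0∞} {K : ℝ≥0}

lemma ne_top_of_sum_le_mul (h : ∀ᶠ n : ℕ in atTop, ∑ i ∈ Icc 1 n, a i ≤ K * n) {n : ℕ}
    (hn : 1 ≤ n) : a n ≠ ∞ := by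
  obtain ⟨N, hN, hnN⟩ := (h.and (eventually_ge_atTop n)).exists
  refine ne_top_of_le_ne_top (by finiteness) (hN.trans' ?_)
  exact single_le_sum (fun _ _ => zero_le) (mem_Icc.2 ⟨hn, hnN⟩)

lemma exists_sum_toReal_le_mul (h : ∀ᶠ n : ℕ in atTop, ∑ i ∈ Icc 1 n, a i ≤ K * n) :
    ∃ B : ℝ≥0, ∀ n, 1 ≤ n → ∑ i ∈ Icc 1 n, (a i).toReal ≤ B * n := by
  obtain ⟨N, hN⟩ := eventually_atTop.1 h
  refine ⟨K * (N + 1), fun n hn => ?_⟩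
  have hnN : n + N ≤ (N + 1) * n := by nlinarith
  calc ∑ i ∈ Icc 1 n, (a i).toReal ≤ ∑ i ∈ Icc 1 (n + N), (a i).toReal :=
        sum_le_sum_of_subset_of_nonneg (Icc_subset_Icc_right (Nat.le_add_right n N))
          fun _ _ _ => ENNReal.toReal_nonneg
    _ = (∑ i ∈ Icc 1 (n + N), a i).toReal :=
        (ENNReal.toReal_sum fun i hi => ne_top_of_sum_le_mul h (mem_Icc.1 hi).1).symm
    _ ≤ K * (n + N : ℕ) := by
        have := ENNReal.toReal_mono (by finiteness) (hN (n + N) (Nat.le_add_left N n))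
        rwa [ENNReal.toReal_mul, ENNReal.toReal_natCast] at this
    _ ≤ K * ((N + 1) * n : ℕ) := by gcongr
    _ = (K * (N + 1) : ℝ≥0) * n := by push_cast; ring

end LinearGrowth

section ConvolutionProducts

open Real (pi)
open scoped Real

variable {ν : ℕ → Measure ℤ}

lemma isProbabilityMeasure_convProd (hprob : ∀ n, 1 ≤ n → IsProbabilityMeasure (ν n)) :
    ∀ n, IsProbabilityMeasure (convProd ν n)
  | 0 => Measure.dirac.isProbabilityMeasure
  | n + 1 => by
    have := isProbabilityMeasure_convProd hprob n
    have := hprob (n + 1) n.succ_pos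
    exact Measure.probabilitymeasure_of_probabilitymeasures_conv _ _

lemma memLp_intCast_convProd {p : ℝ≥0∞} (hprob : ∀ n, 1 ≤ n → IsProbabilityMeasure (ν n))
    (h : ∀ n, 1 ≤ n → MemLp ((↑) : ℤ → ℝ) p (ν n)) :
    ∀ n, MemLp ((↑) : ℤ → ℝ) p (convProd ν n)
  | 0 => (memLp_congr_ae (ae_eq_dirac _)).2 (memLp_const _)
  | n + 1 => by
    have := isProbabilityMeasure_convProd hprob n
    have := hprob (n + 1) n.succ_pos
    exact memLp_intCast_conv (memLp_intCast_convProd hprob h n) (h (n + 1) n.succ_pos)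

lemma fourier_convProd (hprob : ∀ n, 1 ≤ n → IsProbabilityMeasure (ν n)) :
    ∀ n, fourier (convProd ν n) = ∏ i ∈ Icc 1 n, fourier (ν i)
  | 0 => by
    ext t
    simp [convProd, fourier_eq_charFun, Measure.map_dirac, charFun_dirac]
  | n + 1 => by
    have := isProbabilityMeasure_convProd hprob n
    have := hprob (n + 1) n.succ_pos
    rw [convProd, fourier_conv, fourier_convProd hprob n, prod_Icc_succ_top n.succ_pos]

lemma norm_iteratedDeriv_two_fourier_convProd_le
    (hprob : ∀ n, 1 ≤ n → IsProbabilityMeasure (ν n))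
    (hmean : ∀ n, 1 ≤ n → expectation (ν n) = 0)
    (hmom : ∀ n, 1 ≤ n → MemLp ((↑) : ℤ → ℝ) 2 (ν n)) {t G : ℝ} {b : ℕ → ℝ}
    (hb : ∀ n, 1 ≤ n → ‖fourier (ν n) t‖ ≤ b n) (hG : ∀ n, 1 ≤ n → 1 ≤ G * b n) (n : ℕ) :
    ‖iteratedDeriv 2 (fourier (convProd ν n)) t‖ ≤
      (G * ∑ i ∈ Icc 1 n, (2 * π) ^ 2 * (secondMoment (ν i)).toReal +
        (G * (∑ i ∈ Icc 1 n, (2 * π) ^ 2 * (secondMoment (ν i)).toReal) * |t|) ^ 2) *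
      ∏ i ∈ Icc 1 n, b i := by
  have hscale {i : ℕ} (hi : 1 ≤ i) {r : ℝ} (hr : 0 ≤ r) : r ≤ G * r * b i := by
    rw [mul_right_comm]
    exact le_mul_of_one_le_left hr (hG i hi)
  rw [fourier_convProd hprob, mul_sum, sum_mul]
  refine norm_iteratedDeriv_two_prod_le (fun i hi => ?_) (fun i hi => ?_) (fun i hi => ?_)
    fun i hi => ?_
  all_goals
    replace hi := (mem_Icc.1 hi).1
    have := hprob i hi
  · exact (contDiff_fourier (n := 2) (hmom i hi)).contDiffAt
  · exact hb i hi
  · refine (norm_deriv_fourier_le (hmom i hi) (hmean i hi) t).trans ?_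
    rw [mul_assoc G]
    exact hscale hi (by positivity)
  · exact (norm_iteratedDeriv_two_fourier_le (hmom i hi) t).trans (hscale hi (by positivity))

lemma prod_ite_mul_le {G q : ℝ} (hG : 1 ≤ G) (hq : 0 ≤ q) (N n : ℕ) :
    ∏ i ∈ Icc 1 n, (if i ≤ N then G else 1) * q ≤ G ^ N * q ^ n := by
  have hcard : #{i ∈ Icc 1 n | i ≤ N} ≤ N := by
    simpa using card_le_card (t := Icc 1 N) fun i hi => by simp_all
  rw [prod_mul_distrib, prod_const, Nat.card_Icc, Nat.add_sub_cancel, prod_ite, prod_const,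
    prod_const_one, mul_one]
  gcongr

lemma norm_iteratedDeriv_two_fourier_convProd_le_exp
    (hprob : ∀ n, 1 ≤ n → IsProbabilityMeasure (ν n))
    (hmean : ∀ n, 1 ≤ n → expectation (ν n) = 0)
    (hmom : ∀ n, 1 ≤ n → MemLp ((↑) : ℤ → ℝ) 2 (ν n)) {C : ℝ} (hC : 0 ≤ C) {N : ℕ} {t : ℝ}
    (hdecay : ∀ n, N < n → ‖fourier (ν n) t‖ ≤ Real.exp (-C * t ^ 2)) (ht : |t| ≤ 1 / 2) (n : ℕ)
    {S : ℝ} (hS : ∑ i ∈ Icc 1 n, (2 * π) ^ 2 * (secondMoment (ν i)).toReal ≤ S) :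
    ‖iteratedDeriv 2 (fourier (convProd ν n)) t‖ ≤
      Real.exp (C / 4) ^ N * (Real.exp (C / 4) * S + (Real.exp (C / 4) * S) ^ 2 * |t| ^ 2) *
        Real.exp (-(C * n) * t ^ 2) := by
  set G := Real.exp (C / 4)
  set q := Real.exp (-C * t ^ 2)
  have hG : 1 ≤ G := Real.one_le_exp (by positivity)
  have hGq : 1 ≤ G * q := by
    have ht2 : t ^ 2 ≤ (1 / 2) ^ 2 := sq_le_sq' (abs_le.1 ht).1 (abs_le.1 ht).2
    rw [← Real.exp_add]
    exact Real.one_le_exp (by nlinarith)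
  have hdecay_ite (i : ℕ) (hi : 1 ≤ i) : ‖fourier (ν i) t‖ ≤ (if i ≤ N then G else 1) * q := by
    split_ifs with hiN
    · have := hprob i hi
      exact (norm_fourier_le_one t).trans hGq
    · simpa using hdecay i (not_le.1 hiN)
  have hscale (i : ℕ) (_ : 1 ≤ i) : 1 ≤ G * ((if i ≤ N then G else 1) * q) := by
    split_ifs
    · exact hGq.trans (le_mul_of_one_le_left (by positivity) hG)
    · simpa using hGq
  refine (norm_iteratedDeriv_two_fourier_convProd_le hprob hmean hmom hdecay_ite hscale n).trans ?_
  calc _ ≤ (G * S + (G * S * |t|) ^ 2) * (G ^ N * q ^ n) := by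
        have hS0 : 0 ≤ S := hS.trans' (by positivity)
        gcongr
        exact prod_ite_mul_le hG (by positivity) N n
    _ = _ := by
        have hqn : q ^ n = Real.exp (-(C * n) * t ^ 2) := by
          rw [← Real.exp_nat_mul]
          ring_nf
        rw [hqn, mul_pow, mul_left_comm, ← mul_assoc]

lemma integral_norm_iteratedDeriv_two_fourier_convProd_le
    (hprob : ∀ n, 1 ≤ n → IsProbabilityMeasure (ν n))
    (hmean : ∀ n, 1 ≤ n → expectation (ν n) = 0)
    (hmom : ∀ n, 1 ≤ n → MemLp ((↑) : ℤ → ℝ) 2 (ν n)) {C : ℝ} (hC : 0 < C) {N : ℕ}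
    (hdecay : ∀ n, N < n → ∀ t ∈ Set.Ico (-(1 / 2) : ℝ) (1 / 2),
      ‖fourier (ν n) t‖ ≤ Real.exp (-C * t ^ 2)) {n : ℕ} (hn : 1 ≤ n) {β : ℝ}
    (hβ : ∑ i ∈ Icc 1 n, (2 * π) ^ 2 * (secondMoment (ν i)).toReal ≤ β * n) :
    ∫ t in (-(1 / 2) : ℝ)..(1 / 2), ‖iteratedDeriv 2 (fourier (convProd ν n)) t‖ * |t| ≤
      Real.exp (C / 4) ^ N *
        (Real.exp (C / 4) * β / C + (Real.exp (C / 4) * β / C) ^ 2) := by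
  set G := Real.exp (C / 4)
  have := isProbabilityMeasure_convProd hprob n
  have hcont : Continuous (iteratedDeriv 2 (fourier (convProd ν n))) :=
    (contDiff_fourier (n := 2) (memLp_intCast_convProd hprob hmom n)).continuous_iteratedDeriv 2
      le_rfl
  have : 0 < (n : ℝ) := by exact_mod_cast hn
  have hgauss (k : ℕ) : ∫ t in (-(1 / 2) : ℝ)..(1 / 2),
      |t| ^ (2 * k + 1) * Real.exp (-(C * n) * t ^ 2) ≤ k.factorial / (C * n) ^ (k + 1) :=
    intervalIntegral_abs_pow_mul_exp_neg_mul_sq_le (by positivity) (by norm_num) k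
  calc _ ≤ ∫ t in (-(1 / 2) : ℝ)..(1 / 2), G ^ N *
          (G * (β * n) * (|t| ^ (2 * 0 + 1) * Real.exp (-(C * n) * t ^ 2)) +
            (G * (β * n)) ^ 2 * (|t| ^ (2 * 1 + 1) * Real.exp (-(C * n) * t ^ 2))) := by
        refine intervalIntegral.integral_mono_on_of_le_Ioo (by norm_num)
          (Continuous.intervalIntegrable (by fun_prop) _ _)
          (Continuous.intervalIntegrable (by fun_prop) _ _) fun t ht => ?_
        have hbound := norm_iteratedDeriv_two_fourier_convProd_le_exp hprob hmean hmom hC.le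
          (fun i hi => hdecay i hi t ⟨ht.1.le, ht.2⟩) (abs_le.2 ⟨ht.1.le, ht.2.le⟩) n hβ
        exact (mul_le_mul_of_nonneg_right hbound (abs_nonneg t)).trans_eq (by ring)
    _ = G ^ N * (G * (β * n) * (∫ t in (-(1 / 2) : ℝ)..(1 / 2),
            |t| ^ (2 * 0 + 1) * Real.exp (-(C * n) * t ^ 2)) +
          (G * (β * n)) ^ 2 * ∫ t in (-(1 / 2) : ℝ)..(1 / 2),
            |t| ^ (2 * 1 + 1) * Real.exp (-(C * n) * t ^ 2)) := by
        rw [intervalIntegral.integral_const_mul, intervalIntegral.integral_add,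
          intervalIntegral.integral_const_mul, intervalIntegral.integral_const_mul]
        all_goals exact Continuous.intervalIntegrable (by fun_prop) _ _
    _ ≤ G ^ N * (G * (β * n) * (Nat.factorial 0 / (C * n) ^ (0 + 1)) +
          (G * (β * n)) ^ 2 * (Nat.factorial 1 / (C * n) ^ (1 + 1))) := by
        have hβ0 : 0 ≤ β * n := hβ.trans' (by positivity)
        gcongr <;> exact hgauss _
    _ = _ := by
        simp only [Nat.factorial_zero, Nat.factorial_one, Nat.cast_one, zero_add, pow_one,
          Nat.reduceAdd]
        field_simp

lemma exists_integral_norm_iteratedDeriv_two_fourier_convProd_le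
    (hprob : ∀ n, 1 ≤ n → IsProbabilityMeasure (ν n))
    (hmean : ∀ n, 1 ≤ n → expectation (ν n) = 0)
    (hmom : ∀ n, 1 ≤ n → MemLp ((↑) : ℤ → ℝ) 2 (ν n))
    (hgrowth : ∃ B : ℝ≥0, ∀ n, 1 ≤ n → ∑ i ∈ Icc 1 n, (secondMoment (ν i)).toReal ≤ B * n)
    (hdecay : ∃ C : ℝ, 0 < C ∧ ∀ᶠ n in atTop, ∀ t ∈ Set.Ico (-(1 / 2) : ℝ) (1 / 2),
      ‖fourier (ν n) t‖ ≤ Real.exp (-C * t ^ 2)) :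
    ∃ J : ℝ, ∀ n, 1 ≤ n →
      ∫ t in (-(1 / 2) : ℝ)..(1 / 2), ‖iteratedDeriv 2 (fourier (convProd ν n)) t‖ * |t| ≤ J := by
  obtain ⟨B, hB⟩ := hgrowth
  obtain ⟨C, hC, hCdecay⟩ := hdecay
  obtain ⟨N, hN⟩ := eventually_atTop.1 hCdecay
  refine ⟨_, fun n hn => integral_norm_iteratedDeriv_two_fourier_convProd_le hprob hmean hmom hC
    (fun i hi => hN i hi.le) hn (β := (2 * π) ^ 2 * B) ?_⟩
  rw [← mul_sum, mul_assoc]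
  gcongr
  exact hB n hn

lemma lintegral_Icc_eq_ofReal_intervalIntegral {g : ℝ → ℝ} (hg : Continuous g) (h0 : 0 ≤ g)
    {a b : ℝ} (hab : a ≤ b) :
    ∫⁻ t in Set.Icc a b, ENNReal.ofReal (g t) = ENNReal.ofReal (∫ t in a..b, g t) := by
  rw [intervalIntegral.integral_of_le hab, ← integral_Icc_eq_integral_Ioc,
    ofReal_integral_eq_lintegral_ofReal hg.integrableOn_Icc (ae_of_all _ h0)]

end ConvolutionProducts

end ConvolutionAverages

end

open ConvolutionAverages in
theorem theorem2p1p3_general {X : Type*} [MeasurableSpace X] (m : Measure X)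
    (τ : X ≃ᵐ X) (hτ : MeasurePreserving τ m m)
    (ν : ℕ → Measure ℤ) (hprob : ∀ n, 1 ≤ n → IsProbabilityMeasure (ν n))
    (hmean : ∀ n, 1 ≤ n → expectation (ν n) = 0)
    (hmom : ∃ K : ℝ≥0, ∀ᶠ n : ℕ in atTop, ∑ i ∈ Finset.Icc 1 n, secondMoment (ν i) ≤ K * n)
    (hgauss : ∃ C : ℝ, 0 < C ∧ ∀ᶠ n in atTop, ∀ t ∈ Set.Ico (-(1 / 2) : ℝ) (1 / 2),
      ‖fourier (ν n) t‖ ≤ Real.exp (-C * t ^ 2)) :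
    ((∀ n, 1 ≤ n → ContDiff ℝ 2 (fourier (convProd ν n))) ∧
      (⨆ (n : ℕ) (_ : 1 ≤ n), ∫⁻ t in Set.Icc (-(1 / 2) : ℝ) (1 / 2),
        ENNReal.ofReal (‖iteratedDeriv 2 (fourier (convProd ν n)) t‖ * |t|)) < ∞) ∧
    WeakType11 m (maximal τ (convProd ν)) := by
  obtain ⟨K, hK⟩ := hmom
  have hmem (n) (hn : 1 ≤ n) : MemLp ((↑) : ℤ → ℝ) 2 (ν n) :=
    memLp_two_intCast (ne_top_of_sum_le_mul hK hn)
  have hconv (n) := memLp_intCast_convProd hprob hmem n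
  have hprob_conv := isProbabilityMeasure_convProd hprob
  have hsmooth (n) : ContDiff ℝ 2 (fourier (convProd ν n)) := contDiff_fourier (n := 2) (hconv n)
  obtain ⟨J, hJ⟩ := exists_integral_norm_iteratedDeriv_two_fourier_convProd_le hprob hmean hmem
    (exists_sum_toReal_le_mul hK) hgauss
  refine ⟨⟨fun n _ => hsmooth n, ?_⟩, weakType11_maximal hτ (fun n _ => hprob_conv n) fun n hn =>
    hasDecayingDifferences_of_integral_le (hconv n) (hJ n hn)⟩
  refine (iSup₂_le fun n hn => ?_).trans_lt (ENNReal.ofReal_lt_top (r := J))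
  have := (hsmooth n).continuous_iteratedDeriv 2 le_rfl
  rw [lintegral_Icc_eq_ofReal_intervalIntegral (by fun_prop) (fun _ => by positivity) (by norm_num)]
  exact ENNReal.ofReal_le_ofReal (hJ n hn)

theorem theorem2p1p3 {X : Type*} [MeasurableSpace X] (m : Measure X) [IsProbabilityMeasure m]
    (τ : X ≃ᵐ X) (hτ : MeasurePreserving τ m m)
    (ν : ℕ → Measure ℤ) (hprob : ∀ n, 1 ≤ n → IsProbabilityMeasure (ν n))
    (haper : ∀ n, 1 ≤ n → ConvolutionAverages.StrictlyAperiodic (ν n))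
    (hmean : ∀ n, 1 ≤ n → ConvolutionAverages.expectation (ν n) = 0)
    (hmom : ∃ K : ℝ≥0, ∀ᶠ n : ℕ in atTop,
      ∑ i ∈ Finset.Icc 1 n, ConvolutionAverages.secondMoment (ν i) ≤ (K : ℝ≥0∞) * (n : ℝ≥0∞))
    (hgauss : ∃ C : ℝ, 0 < C ∧ ∃ N₀ : ℕ, 0 < N₀ ∧ ∀ n, N₀ < n →
      ∀ t ∈ Set.Ico (-(1 / 2) : ℝ) (1 / 2),
        ‖ConvolutionAverages.fourier (ν n) t‖ ≤ Real.exp (-C * t ^ 2)) :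
    ((∀ n, 1 ≤ n →
        ContDiff ℝ 2 (ConvolutionAverages.fourier (ConvolutionAverages.convProd ν n))) ∧
      (⨆ (n : ℕ) (_ : 1 ≤ n), ∫⁻ t in Set.Icc (-(1 / 2) : ℝ) (1 / 2),
        ENNReal.ofReal
          (‖iteratedDeriv 2
            (ConvolutionAverages.fourier (ConvolutionAverages.convProd ν n)) t‖ * |t|)) < ∞) ∧
    ConvolutionAverages.WeakType11 m
      (ConvolutionAverages.maximal τ (ConvolutionAverages.convProd ν)) :=
  theorem2p1p3_general m τ hτ ν hprob hmean hmom <|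
    hgauss.imp fun _ ⟨hC, N₀, _, h⟩ => ⟨hC, (eventually_gt_atTop N₀).mono h⟩
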